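/- There exists $\epsilon>0$ such that for every complex Banach algebra $A$ (not necessarily unital; exponentials and logarithms are taken in the unitization $\mathbb{C}\oplus A$) there exist maps $R,S,R',R'',S',S''$ from $\{(X,Y)\in A\times A : \|X\|\le\epsilon,\ \|Y\|\le\epsilon\}$ to $A$ with the following properties. Write $[X,Z]=XZ-ZX$, $e^{R}\cdot X=e^{R}Xe^{-R}\in A$, and, for $U,W\in A$ with $\|U\|+\|W\|<\log 2$, $V(U,W)=\log(e^{U}e^{W})$, where $\log(b)=\sum_{n\ge1}\frac{(-1)^{n-1}}{n}(b-1)^n$ for $\|b-1\|<1$. 1. $R$ and $S$ are continuous and $R(0,0)=S(0,0)=0$. 2. For all $X,Y\in A$ with $\|X\|,\|Y\|\le\epsilon$, writing $R=R(X,Y)$, $R'=R'(X,Y)$, etc., one has $\|e^{R}\cdot X\|+\|e^{S}\cdot Y\|<\log 2$ and $$V(e^{R}\cdot X,\;e^{S}\cdot Y)=X+Y,\qquad e^{X+Y}=(e^{R}e^{X}e^{-R})(e^{S}e^{Y}e^{-S}),$$ $$R=\tfrac{Y}{4}+[X,R']+[Y,R''],\qquad S=-\tfrac{X}{4}+[X,S']+[Y,S''].$$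 3. If moreover $A$ is a $\mathrm{C}^*$-algebra and $X,Y$ (with $\|X\|,\|Y\|\le\epsilon$) are skewadjoint ($X^*=-X$, $Y^*=-Y$), then $R,R',R'',S,S',S''$ at $(X,Y)$ are all skewadjoint. -/

import Mathlib

/-!
Banach algebras are complex, complete and not necessarily unital.  The algebra `A` sits in its
unitization `ℂ ⊕ A` (with the complete submultiplicative norm `|z| + ‖a‖`), where exponentials,
conjugations by exponentials and logarithms of elements of `1 + A` are computed.
-/

namespace BanachKV

noncomputable section

section General

variable {B : Type*} [NormedRing B] [NormedAlgebra ℂ B]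

/-- `log b = ∑_{n ≥ 0} (-1)ⁿ (b - 1)ⁿ⁺¹ / (n + 1)`, the logarithm of a unital Banach algebra on the
ball `‖b - 1‖ < 1`. There it is the principal branch of the logarithm in the holomorphic functional
calculus; it is used on that ball only. -/
def log (b : B) : B :=
  ∑' n : ℕ, ((-1 : ℂ) ^ n / ((n : ℂ) + 1)) • (b - 1) ^ (n + 1)

end General

variable {A : Type*} [NonUnitalNormedRing A] [NormedSpace ℂ A]
  [IsScalarTower ℂ A A] [SMulCommClass ℂ A A]

/-- The inclusion of `A` in its unitization. -/
def incl (a : A) : WithLp 1 (Unitization ℂ A) :=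
  WithLp.toLp 1 (a : Unitization ℂ A)

/-- The exponential `e^a` of `a : A`, an element of `1 + A` in the unitization. -/
def expA (a : A) : WithLp 1 (Unitization ℂ A) :=
  NormedSpace.exp (incl a)

/-- `e^R · X = e^R X e^{-R}`, which is an element of the ideal `A` of the unitization
(see `incl_conjExp`). -/
def conjExp (R X : A) : A :=
  (WithLp.ofLp (expA R * incl X * expA (-R))).snd

theorem incl_conjExp (R X : A) : incl (conjExp R X) = expA R * incl X * expA (-R) := by
  apply WithLp.ofLp_injective
  apply Unitization.ext <;> simp [conjExp, incl]

/-- `V(X, Y) = log (e^X e^Y)`, for `‖X‖ + ‖Y‖ < log 2`. -/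
def V (X Y : A) : WithLp 1 (Unitization ℂ A) :=
  log (expA X * expA Y)

end

end BanachKV

namespace BanachKV
noncomputable section

/-! ### The free Banach algebra on two generators -/

/-- Noncommutative real polynomials in two variables, with the `ℓ¹` norm of the coefficients. -/
abbrev FreePoly : Type := MonoidAlgebra ℝ (FreeMonoid Bool)

namespace FreePoly

/-- The monomial of a word. -/
def word (w : FreeMonoid Bool) : FreePoly := MonoidAlgebra.single w 1

theorem word_mul (v w : FreeMonoid Bool) : word v * word w = word (v * w) := by
  simp [word, MonoidAlgebra.single_mul_single]

theorem word_one : word 1 = 1 := rfl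

/-- The sum of the absolute values of the coefficients. -/
def l1 (a : FreePoly) : ℝ := (MonoidAlgebra.coeff a).sum fun _ c => |c|

theorem l1_add_le (a b : FreePoly) : l1 (a + b) ≤ l1 a + l1 b := by
  classical
  have key : ∀ c : FreePoly, (MonoidAlgebra.coeff c).support ⊆
      (MonoidAlgebra.coeff a).support ∪ (MonoidAlgebra.coeff b).support →
      l1 c = ∑ w ∈ (MonoidAlgebra.coeff a).support ∪ (MonoidAlgebra.coeff b).support,
        |MonoidAlgebra.coeff c w| := fun c hc =>
    Finsupp.sum_of_support_subset _ hc _ (by simp)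
  rw [key a Finset.subset_union_left, key b Finset.subset_union_right,
    key (a + b) Finsupp.support_add, ← Finset.sum_add_distrib]
  exact Finset.sum_le_sum fun w _ => abs_add_le _ _

theorem l1_smul (c : ℝ) (a : FreePoly) : l1 (c • a) = |c| * l1 a := by
  rcases eq_or_ne c 0 with rfl | hc
  · simp [l1]
  · change ((c • MonoidAlgebra.coeff a).sum fun _ c => |c|) = _
    rw [Finsupp.sum_smul_index (by simp), l1, Finsupp.mul_sum]
    simp [abs_mul]

theorem l1_word (w : FreeMonoid Bool) : l1 (word w) = 1 := by
  simp [l1, word, MonoidAlgebra.coeff_single]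

theorem l1_zero : l1 0 = 0 := by simp [l1]

theorem eq_sum (a : FreePoly) : a = (MonoidAlgebra.coeff a).sum fun w c => c • word w := by
  conv_lhs => rw [← MonoidAlgebra.sum_coeff_single a]
  refine Finsupp.sum_congr fun w _ => ?_
  change _ = _ • MonoidAlgebra.single w (1 : ℝ)
  rw [MonoidAlgebra.smul_single]; simp

theorem l1_sum_le {ι : Type*} (s : Finset ι) (f : ι → FreePoly) :
    l1 (∑ i ∈ s, f i) ≤ ∑ i ∈ s, l1 (f i) :=
  Finset.le_sum_of_subadditive _ l1_zero.le l1_add_le _ _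

theorem l1_mul_le (a b : FreePoly) : l1 (a * b) ≤ l1 a * l1 b := by
  conv_lhs => rw [eq_sum a, eq_sum b]
  rw [Finsupp.sum, Finsupp.sum, Finset.sum_mul_sum]
  rw [show l1 a * l1 b = (∑ v ∈ (MonoidAlgebra.coeff a).support, |MonoidAlgebra.coeff a v|) *
    ∑ w ∈ (MonoidAlgebra.coeff b).support, |MonoidAlgebra.coeff b w| from rfl, Finset.sum_mul_sum]
  refine (l1_sum_le _ _).trans (Finset.sum_le_sum fun v _ => (l1_sum_le _ _).trans
    (Finset.sum_le_sum fun w _ => ?_))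
  rw [smul_mul_smul_comm, word_mul, l1_smul, l1_word, abs_mul, mul_one]

instance : NormedRing FreePoly := RingNorm.toNormedRing
  { toFun := l1
    map_zero' := l1_zero
    add_le' := l1_add_le
    neg' := fun a => by
      have := l1_smul (-1) a
      simpa using this
    mul_le' := l1_mul_le
    eq_zero_of_map_eq_zero' := fun a ha => by
      have h : MonoidAlgebra.coeff a = 0 := by
        ext w
        by_contra hw
        have h1 : |MonoidAlgebra.coeff a w| ≤ l1 a :=
          Finset.single_le_sum (f := fun w => |MonoidAlgebra.coeff a w|)
            (fun i _ => abs_nonneg _) (Finsupp.mem_support_iff.2 hw)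
        have h2 : 0 < |MonoidAlgebra.coeff a w| := abs_pos.2 hw
        have h3 : l1 a = 0 := ha
        linarith
      exact MonoidAlgebra.coeff_injective h }

theorem norm_eq (a : FreePoly) : ‖a‖ = l1 a := rfl

instance : NormedAlgebra ℝ FreePoly where
  norm_smul_le c a := (l1_smul c a).le

/-- The linear map with prescribed values of norm at most `1` on the words. -/
def liftCLM {E : Type*} [NormedAddCommGroup E] [NormedSpace ℝ E] (f : FreeMonoid Bool → E)
    (hf : ∀ w, ‖f w‖ ≤ 1) : FreePoly →L[ℝ] E :=
  LinearMap.mkContinuous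
    ({ toFun := fun a => Finsupp.linearCombination ℝ f (MonoidAlgebra.coeff a)
       map_add' := fun a b => (Finsupp.linearCombination ℝ f).map_add _ _
       map_smul' := fun c a => (Finsupp.linearCombination ℝ f).map_smul c _ } : FreePoly →ₗ[ℝ] E) 1
    (fun a => by
      rw [one_mul]
      refine (norm_sum_le _ _).trans (Finset.sum_le_sum fun w _ => ?_)
      change ‖MonoidAlgebra.coeff a w • f w‖ ≤ |MonoidAlgebra.coeff a w|
      rw [norm_smul]
      exact mul_le_of_le_one_right (abs_nonneg _) (hf w))

theorem liftCLM_word {E : Type*} [NormedAddCommGroup E] [NormedSpace ℝ E] (f : FreeMonoid Bool → E)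
    (hf : ∀ w, ‖f w‖ ≤ 1) (w : FreeMonoid Bool) : liftCLM f hf (word w) = f w := by
  change Finsupp.linearCombination ℝ f (Finsupp.single w 1) = _
  simp

end FreePoly

/-- The free Banach algebra on two generators of norm at most `1`. -/
def FreeBanach : Type := UniformSpace.Completion FreePoly

namespace FreeBanach

instance : NormedRing FreeBanach := inferInstanceAs (NormedRing (UniformSpace.Completion FreePoly))
instance : Algebra ℝ FreeBanach :=
  inferInstanceAs (Algebra ℝ (UniformSpace.Completion FreePoly))
instance : NormedAlgebra ℝ FreeBanach where
  norm_smul_le c a := norm_smul_le (β := UniformSpace.Completion FreePoly) c a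
instance : CompleteSpace FreeBanach :=
  inferInstanceAs (CompleteSpace (UniformSpace.Completion FreePoly))

/-- The inclusion of the polynomials. -/
def ofPoly : FreePoly →L[ℝ] FreeBanach := UniformSpace.Completion.toComplL

theorem norm_ofPoly (a : FreePoly) : ‖ofPoly a‖ = ‖a‖ := UniformSpace.Completion.norm_coe a

theorem ofPoly_mul (a b : FreePoly) : ofPoly (a * b) = ofPoly a * ofPoly b :=
  UniformSpace.Completion.coe_mul a b

theorem ofPoly_one : ofPoly 1 = 1 := UniformSpace.Completion.coe_one FreePoly

theorem denseRange_ofPoly : DenseRange ofPoly := UniformSpace.Completion.denseRange_coe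

/-- The monomial of a word. -/
def word (w : FreeMonoid Bool) : FreeBanach := ofPoly (FreePoly.word w)

theorem word_mul (v w : FreeMonoid Bool) : word v * word w = word (v * w) := by
  rw [word, word, ← ofPoly_mul, FreePoly.word_mul, word]

theorem word_one : word 1 = 1 := by rw [word, FreePoly.word_one, ofPoly_one]

theorem norm_word (w : FreeMonoid Bool) : ‖word w‖ = 1 := by
  rw [word, norm_ofPoly, FreePoly.norm_eq, FreePoly.l1_word]

instance : NormOneClass FreeBanach := ⟨by rw [← word_one, norm_word]⟩

/-- The first generator. -/
def gx : FreeBanach := word (FreeMonoid.of true)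

/-- The second generator. -/
def gy : FreeBanach := word (FreeMonoid.of false)

theorem eq_top_of_word_mem (S : Submodule ℝ FreeBanach) (hS : IsClosed (S : Set FreeBanach))
    (h : ∀ w, word w ∈ S) (a : FreeBanach) : a ∈ S := by
  refine denseRange_ofPoly.induction_on (p := (· ∈ S)) a hS fun b => ?_
  rw [FreePoly.eq_sum b, Finsupp.sum, map_sum]
  refine S.sum_mem fun w _ => ?_
  rw [map_smul]
  exact S.smul_mem _ (h w)

section lift

variable {E : Type*} [NormedAddCommGroup E] [NormedSpace ℝ E]

theorem clm_ext {f g : FreeBanach →L[ℝ] E} (h : ∀ w, f (word w) = g (word w)) : f = g := by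
  ext a
  exact eq_top_of_word_mem (LinearMap.eqLocus f.toLinearMap g.toLinearMap)
    (isClosed_eq f.continuous g.continuous) h a

variable [CompleteSpace E]

/-- The linear map with prescribed values of norm at most `1` on the words. -/
def liftCLM (f : FreeMonoid Bool → E) (hf : ∀ w, ‖f w‖ ≤ 1) : FreeBanach →L[ℝ] E :=
  (FreePoly.liftCLM f hf).extend ofPoly

theorem liftCLM_ofPoly (f : FreeMonoid Bool → E) (hf : ∀ w, ‖f w‖ ≤ 1) (a : FreePoly) :
    liftCLM f hf (ofPoly a) = FreePoly.liftCLM f hf a :=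
  ContinuousLinearMap.extend_eq _ denseRange_ofPoly
    (UniformSpace.Completion.isUniformInducing_coe FreePoly) a

theorem liftCLM_word (f : FreeMonoid Bool → E) (hf : ∀ w, ‖f w‖ ≤ 1) (w : FreeMonoid Bool) :
    liftCLM f hf (word w) = f w := by
  rw [word, liftCLM_ofPoly, FreePoly.liftCLM_word]

theorem norm_liftCLM_le (f : FreeMonoid Bool → E) (hf : ∀ w, ‖f w‖ ≤ 1) (a : FreeBanach) :
    ‖liftCLM f hf a‖ ≤ ‖a‖ := by
  refine denseRange_ofPoly.induction_on (p := fun a => ‖liftCLM f hf a‖ ≤ ‖a‖) a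
    (isClosed_le (by fun_prop) (by fun_prop)) fun b => ?_
  rw [liftCLM_ofPoly, norm_ofPoly]
  simpa using (FreePoly.liftCLM f hf).le_of_opNorm_le
    (LinearMap.mkContinuous_norm_le _ zero_le_one _) b

end lift

section eval

variable {D : Type*} [NormedRing D] [NormedAlgebra ℝ D] [CompleteSpace D]

/-- The value of a word at a pair of elements. -/
def wordVal (p q : D) : FreeMonoid Bool →* D := FreeMonoid.lift fun i => if i then p else q

omit [NormedAlgebra ℝ D] [CompleteSpace D] in
theorem norm_wordVal_le {p q : D} (h1 : ‖(1 : D)‖ ≤ 1) (hp : ‖p‖ ≤ 1) (hq : ‖q‖ ≤ 1)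
    (w : FreeMonoid Bool) : ‖wordVal p q w‖ ≤ 1 := by
  induction w using FreeMonoid.inductionOn' with
  | one => simpa using h1
  | of_mul i w ih =>
    rw [map_mul]
    refine (norm_mul_le _ _).trans (mul_le_one₀ ?_ (norm_nonneg _) ih)
    cases i <;> simpa [wordVal]

/-- Evaluation of the elements of the free Banach algebra at a pair in the unit ball. -/
theorem exists_eval {p q : D} (h1 : ‖(1 : D)‖ ≤ 1) (hp : ‖p‖ ≤ 1) (hq : ‖q‖ ≤ 1) :
    ∃ θ : FreeBanach →A[ℝ] D, θ gx = p ∧ θ gy = q ∧ ∀ a, ‖θ a‖ ≤ ‖a‖ := by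
  set f := liftCLM (wordVal p q) (norm_wordVal_le h1 hp hq) with hf
  have hw : ∀ w, f (word w) = wordVal p q w := liftCLM_word _ _
  have hmul : ∀ a b, f (a * b) = f a * f b := by
    intro a b
    have h1 : ∀ v, (f.comp ((ContinuousLinearMap.mul ℝ FreeBanach).flip (word v))) =
        ((ContinuousLinearMap.mul ℝ D).flip (f (word v))).comp f := fun v =>
      clm_ext fun w => by simp [word_mul, hw]
    have h2 : f.comp (ContinuousLinearMap.mul ℝ FreeBanach a) =
        (ContinuousLinearMap.mul ℝ D (f a)).comp f :=
      clm_ext fun w => by simpa using DFunLike.congr_fun (h1 w) a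
    simpa using DFunLike.congr_fun h2 b
  have hone : f 1 = 1 := by rw [← word_one, hw, map_one]
  refine ⟨{ AlgHom.ofLinearMap f.toLinearMap hone hmul with cont := f.continuous }, ?_, ?_, ?_⟩
  · exact (hw _).trans (by simp [wordVal])
  · exact (hw _).trans (by simp [wordVal])
  · exact norm_liftCLM_le _ _

end eval

/-- Left division of a word by a letter. -/
def leftDivWord (i : Bool) (w : FreeMonoid Bool) : FreeBanach :=
  match FreeMonoid.toList w with
  | [] => 0
  | j :: l => if j = i then word (FreeMonoid.ofList l) else 0

theorem norm_leftDivWord_le (i : Bool) (w : FreeMonoid Bool) : ‖leftDivWord i w‖ ≤ 1 := by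
  unfold leftDivWord
  split
  · simp
  · split_ifs
    · exact (norm_word _).le
    · simp

/-- Left division by a generator. -/
def leftDiv (i : Bool) : FreeBanach →L[ℝ] FreeBanach :=
  liftCLM (leftDivWord i) (norm_leftDivWord_le i)

/-- The constant term. -/
theorem exists_const_add (θ : FreeBanach →A[ℝ] ℝ) (hx : θ gx = 0) (hy : θ gy = 0)
    (a : FreeBanach) :
    a = algebraMap ℝ FreeBanach (θ a) + gx * leftDiv true a + gy * leftDiv false a := by
  have : ContinuousLinearMap.id ℝ FreeBanach =
      (Algebra.linearMap ℝ FreeBanach).toContinuousLinearMap.comp θ.toContinuousLinearMap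
      + (ContinuousLinearMap.mul ℝ FreeBanach gx).comp (leftDiv true)
      + (ContinuousLinearMap.mul ℝ FreeBanach gy).comp (leftDiv false) := by
    refine clm_ext fun w => ?_
    simp only [ContinuousLinearMap.id_apply, add_apply,
      ContinuousLinearMap.comp_apply, ContinuousLinearMap.mul_apply', leftDiv, liftCLM_word,
      LinearMap.coe_toContinuousLinearMap', Algebra.linearMap_apply,
      ContinuousAlgHom.coe_toContinuousLinearMap]
    induction w using FreeMonoid.inductionOn' with
    | one => simp [word_one, leftDivWord]
    | of_mul i w ih =>
      clear ih
      have h : ∀ j, leftDivWord j (FreeMonoid.of i * w) = if i = j then word w else 0 := by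
        intro j
        simp [leftDivWord]
      rw [h, h, ← word_mul, map_mul]
      cases i
      · have hy' : θ (word (FreeMonoid.of false)) = 0 := hy
        simp [hy', gy]
      · have hx' : θ (word (FreeMonoid.of true)) = 0 := hx
        simp [hx', gx]
  simpa using DFunLike.congr_fun this a

end FreeBanach

open NormedSpace Filter Topology
open scoped Nat

/-! ### Entire functions with bounded exponential coefficients -/

section Entire

variable {B : Type*} [NormedRing B] [NormedAlgebra ℝ B] [CompleteSpace B]

/-- The entire function `∑ (c n / n!) aⁿ`. -/
def ent (c : ℕ → ℝ) (a : B) : B := ∑' n : ℕ, (c n / n !) • a ^ n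

omit [CompleteSpace B] in
theorem summable_norm_ent {c : ℕ → ℝ} (hc : ∀ n, |c n| ≤ 1) (a : B) :
    Summable fun n : ℕ => ‖(c n / n !) • a ^ n‖ := by
  refine (norm_expSeries_summable' (𝕂 := ℝ) a).of_nonneg_of_le (fun n => norm_nonneg _) fun n => ?_
  rw [norm_smul, norm_smul, div_eq_mul_inv, norm_mul, Real.norm_eq_abs]
  refine mul_le_mul_of_nonneg_right ?_ (norm_nonneg _)
  exact mul_le_of_le_one_left (norm_nonneg _) (hc n)

theorem hasSum_ent {c : ℕ → ℝ} (hc : ∀ n, |c n| ≤ 1) (a : B) :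
    HasSum (fun n : ℕ => (c n / n !) • a ^ n) (ent c a) :=
  (summable_norm_ent hc a).of_norm.hasSum

omit [CompleteSpace B] in
theorem ent_zero (c : ℕ → ℝ) : ent c (0 : B) = c 0 • 1 := by
  rw [ent, tsum_eq_single 0 (fun n hn => by simp [hn])]
  simp

omit [CompleteSpace B] in
theorem ent_one_eq_exp (a : B) : ent (fun _ => 1) a = exp a := by
  rw [exp_eq_tsum (𝕂 := ℝ)]
  simp [ent]

/-- The coefficients of the difference quotient of an entire function at `0`. -/
def shift (c : ℕ → ℝ) (n : ℕ) : ℝ := c (n + 1) / (n + 1)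

theorem abs_shift_le {c : ℕ → ℝ} (hc : ∀ n, |c n| ≤ 1) (n : ℕ) : |shift c n| ≤ 1 := by
  rw [shift, abs_div, abs_of_pos (by positivity : (0 : ℝ) < n + 1)]
  exact div_le_one_of_le₀ ((hc _).trans (by linarith [n.cast_nonneg (α := ℝ)])) (by positivity)

theorem ent_eq_add_mul {c : ℕ → ℝ} (hc : ∀ n, |c n| ≤ 1) (a : B) :
    ent c a = c 0 • 1 + a * ent (shift c) a := by
  have h := (hasSum_ent (abs_shift_le hc) a).mul_left a
  have h' : HasSum (fun n : ℕ => (c (n + 1) / (n + 1)!) • a ^ (n + 1)) (a * ent (shift c) a) := by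
    have e : ∀ n : ℕ, a * ((shift c n / n !) • a ^ n) = (c (n + 1) / (n + 1)!) • a ^ (n + 1) := by
      intro n
      rw [mul_smul_comm, ← pow_succ', shift, div_div, Nat.factorial_succ]
      push_cast
      rfl
    simpa only [e] using h
  have := (hasSum_nat_add_iff (f := fun n : ℕ => (c n / n !) • a ^ n) 1).1 h'
  rw [(hasSum_ent hc a).unique this]
  simp [add_comm]

theorem Commute.ent_left {c : ℕ → ℝ} (hc : ∀ n, |c n| ≤ 1) {a b : B} (h : Commute a b) :
    Commute (ent c a) b := by
  have h1 := (hasSum_ent hc a).mul_right b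
  have h2 := (hasSum_ent hc a).mul_left b
  refine h1.unique ?_
  convert h2 using 2 with n
  rw [smul_mul_assoc, mul_smul_comm, (h.pow_left n).eq]

theorem ent_mem {c : ℕ → ℝ} (hc : ∀ n, |c n| ≤ 1) (S : Subalgebra ℝ B)
    (hS : IsClosed (S : Set B)) {a : B} (ha : a ∈ S) : ent c a ∈ S :=
  hS.mem_of_tendsto (hasSum_ent hc a) (Eventually.of_forall fun _ =>
    S.sum_mem fun _ _ => S.smul_mem (S.pow_mem ha _) _)

theorem contDiffAt_ent {c : ℕ → ℝ} (hc : ∀ n, |c n| ≤ 1) : ContDiffAt ℝ 1 (ent c : B → B) 0 := by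
  set p := FormalMultilinearSeries.ofScalars B (fun n : ℕ => c n / n !) with hp
  have hr : 0 < p.radius := by
    refine lt_of_lt_of_le (by norm_num) (p.le_radius_of_bound (max ‖p 0‖ 1) (r := 1) fun n => ?_)
    rcases Nat.eq_zero_or_pos n with rfl | hn
    · simp
    · refine le_trans ?_ (le_max_right _ _)
      rw [NNReal.coe_one, one_pow, mul_one]
      refine (FormalMultilinearSeries.ofScalars_norm_le _ _ n hn).trans ?_
      rw [Real.norm_eq_abs, abs_div, Nat.abs_cast]
      exact div_le_one_of_le₀ ((hc n).trans (by exact_mod_cast n.factorial_pos)) (by positivity)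
  have h := p.hasFPowerSeriesOnBall hr
  have : p.sum = ent c := by
    ext a
    exact FormalMultilinearSeries.ofScalars_sum_eq _ a
  rw [this] at h
  exact h.analyticAt.contDiffAt

/-- Coefficients of `φ(z) = (eᶻ - 1) / z`. -/
def cphi (n : ℕ) : ℝ := 1 / (n + 1)

/-- Coefficients of `(eᶻ - φ(z)) / z`. -/
def ceta (n : ℕ) : ℝ := 1 / (n + 2)

theorem abs_one_le (_ : ℕ) : |(1 : ℝ)| ≤ 1 := by simp

theorem abs_cphi_le (n : ℕ) : |cphi n| ≤ 1 := by
  rw [cphi, abs_of_pos (by positivity)]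
  exact div_le_one_of_le₀ (by linarith [n.cast_nonneg (α := ℝ)]) (by positivity)

theorem abs_ceta_le (n : ℕ) : |ceta n| ≤ 1 := by
  rw [ceta, abs_of_pos (by positivity)]
  exact div_le_one_of_le₀ (by linarith [n.cast_nonneg (α := ℝ)]) (by positivity)

theorem exp_eq_one_add_mul_phi (a : B) : exp a = 1 + a * ent cphi a := by
  rw [← ent_one_eq_exp, ent_eq_add_mul abs_one_le, one_smul]
  rfl

theorem exp_eq_phi_add_mul_eta (a : B) : exp a = ent cphi a + a * ent ceta a := by
  have h : ent cphi a = ent (shift cphi) a + ent ceta a := by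
    refine (hasSum_ent abs_cphi_le a).unique ?_
    convert (hasSum_ent (abs_shift_le abs_cphi_le) a).add (hasSum_ent abs_ceta_le a) using 2 with n
    rw [← add_smul, ← add_div]
    congr 2
    simp only [cphi, shift, ceta]
    push_cast
    field_simp
    ring
  have h2 := ent_eq_add_mul abs_cphi_le a
  have h3 := congrArg (a * ·) h
  simp only [mul_add] at h3
  rw [exp_eq_one_add_mul_phi, h3, ← add_assoc]
  congr 1
  rw [h2]
  simp [cphi]

theorem norm_phi_sub_one_lt {a : B} (ha : ‖a‖ ≤ 1 / 2) : ‖1 - ent cphi a‖ < 1 := by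
  have h1 : ent cphi a = 1 + a * ent (shift cphi) a := by
    rw [ent_eq_add_mul abs_cphi_le a]; simp [cphi]
  have h2 := (hasSum_ent (abs_shift_le abs_cphi_le) a).mul_left a
  have h3 : ∀ n : ℕ, ‖a * ((shift cphi n / n !) • a ^ n)‖ ≤ 1 / 4 * (1 / 2) ^ n := by
    intro n
    rw [mul_smul_comm, ← pow_succ', norm_smul]
    have h4 : ‖a ^ (n + 1)‖ ≤ (1 / 2) ^ (n + 1) :=
      (norm_pow_le' a (Nat.succ_pos n)).trans (pow_le_pow_left₀ (norm_nonneg _) ha _)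
    have h5 : ‖shift cphi n / (n ! : ℝ)‖ ≤ 1 / 2 := by
      simp only [shift, cphi]
      rw [Real.norm_of_nonneg (by positivity), div_div, div_div,
        div_le_div_iff₀ (by positivity) (by positivity)]
      have : (1 : ℝ) ≤ (n ! : ℝ) := by exact_mod_cast n.factorial_pos
      push_cast
      have h6 : (0 : ℝ) ≤ n := n.cast_nonneg
      nlinarith [mul_nonneg h6 h6, mul_nonneg h6 (by linarith : (0 : ℝ) ≤ (n ! : ℝ)),
        mul_nonneg (mul_nonneg h6 h6) (by linarith : (0 : ℝ) ≤ (n ! : ℝ))]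
    calc _ ≤ 1 / 2 * (1 / 2) ^ (n + 1) := mul_le_mul h5 h4 (norm_nonneg _) (by norm_num)
      _ = _ := by ring
  have h4 := tsum_of_norm_bounded ((hasSum_geometric_two).mul_left (1 / 4 : ℝ)) h3
  rw [h2.tsum_eq] at h4
  rw [h1, sub_add_cancel_left, norm_neg]
  linarith

/-- The function `z / (eᶻ - 1)`. -/
def nu (a : B) : B := Ring.inverse (ent cphi a)

theorem isUnit_phi {a : B} (ha : ‖a‖ ≤ 1 / 2) : IsUnit (ent cphi a) := by
  have := (Units.oneSub _ (norm_phi_sub_one_lt ha)).isUnit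
  simpa using this

theorem phi_mul_nu {a : B} (ha : ‖a‖ ≤ 1 / 2) : ent cphi a * nu a = 1 :=
  Ring.mul_inverse_cancel _ (isUnit_phi ha)

theorem nu_mul_phi {a : B} (ha : ‖a‖ ≤ 1 / 2) : nu a * ent cphi a = 1 :=
  Ring.inverse_mul_cancel _ (isUnit_phi ha)

theorem nu_mem (S : Subalgebra ℝ B) (hS : IsClosed (S : Set B)) {a : B} (ha : a ∈ S)
    (hn : ‖a‖ ≤ 1 / 2) : nu a ∈ S := by
  have h := NormedRing.inverse_one_sub _ (norm_phi_sub_one_lt hn)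
  rw [sub_sub_cancel] at h
  rw [nu, h]
  have h2 : HasSum (fun n : ℕ => (1 - ent cphi a) ^ n)
      (↑(Units.oneSub _ (norm_phi_sub_one_lt hn))⁻¹ : B) :=
    (summable_geometric_of_norm_lt_one (norm_phi_sub_one_lt hn)).hasSum
  exact hS.mem_of_tendsto h2 (Eventually.of_forall fun _ => S.sum_mem fun _ _ =>
    S.pow_mem (S.sub_mem S.one_mem (ent_mem abs_cphi_le S hS ha)) _)

theorem contDiffAt_nu : ContDiffAt ℝ 1 (nu : B → B) 0 := by
  have h : ent cphi (0 : B) = ((1 : Bˣ) : B) := by simp [ent_zero, cphi]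
  have := contDiffAt_ringInverse ℝ (n := 1) (1 : Bˣ)
  rw [← h] at this
  exact this.comp 0 (contDiffAt_ent abs_cphi_le)

end Entire

section Operators

variable {E F : Type*} [NormedAddCommGroup E] [NormedSpace ℝ E] [CompleteSpace E]
  [NormedAddCommGroup F] [NormedSpace ℝ F] [CompleteSpace F]

theorem hasSum_ent_apply {c : ℕ → ℝ} (hc : ∀ n, |c n| ≤ 1) (Q : E →L[ℝ] E) (f : E) :
    HasSum (fun n : ℕ => (c n / n !) • (Q ^ n) f) (ent c Q f) :=
  (hasSum_ent hc Q).mapL (ContinuousLinearMap.apply ℝ E f)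

theorem map_ent_apply {c : ℕ → ℝ} (hc : ∀ n, |c n| ≤ 1) {Q : E →L[ℝ] E} {Q' : F →L[ℝ] F}
    (θ : E →L[ℝ] F) (h : ∀ f, θ (Q f) = Q' (θ f)) (f : E) :
    θ (ent c Q f) = ent c Q' (θ f) := by
  have hpow : ∀ (n : ℕ) f, θ ((Q ^ n) f) = (Q' ^ n) (θ f) := by
    intro n
    induction n with
    | zero => simp
    | succ n ih => intro f; rw [pow_succ', pow_succ', mul_apply_eq_comp, h, ih]; rfl
  refine ((hasSum_ent_apply hc Q f).mapL θ).unique ?_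
  simpa only [map_smul, hpow] using hasSum_ent_apply hc Q' (θ f)

end Operators

/-! ### The adjoint representation and the derivative of the exponential -/

section Ad

variable {B : Type*} [NormedRing B] [NormedAlgebra ℝ B]

/-- `ad a f = a f - f a`. -/
def ad : B →L[ℝ] B →L[ℝ] B := ContinuousLinearMap.mul ℝ B - (ContinuousLinearMap.mul ℝ B).flip

theorem ad_apply (a f : B) : ad a f = a * f - f * a := rfl

theorem norm_ad_le (a : B) : ‖ad a‖ ≤ 2 * ‖a‖ := by
  refine ContinuousLinearMap.opNorm_le_bound _ (by positivity) fun f => ?_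
  rw [ad_apply]
  refine (norm_sub_le _ _).trans ?_
  linarith [norm_mul_le a f, norm_mul_le f a, mul_comm ‖f‖ ‖a‖]

variable [CompleteSpace B]

theorem continuous_exp : Continuous (exp : B → B) :=
  letI : NormedAlgebra ℚ B := NormedAlgebra.restrictScalars ℚ ℝ B
  exp_continuous

theorem exp_add_of_comm {a b : B} (h : Commute a b) : exp (a + b) = exp a * exp b :=
  letI : NormedAlgebra ℚ B := NormedAlgebra.restrictScalars ℚ ℝ B
  exp_add_of_commute h

theorem exp_mul_exp_neg (a : B) : exp a * exp (-a) = 1 := by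
  rw [← exp_add_of_comm (Commute.refl a).neg_right, add_neg_cancel, exp_zero]

theorem exp_neg_mul_exp (a : B) : exp (-a) * exp a = 1 := by
  simpa using exp_mul_exp_neg (-a)

theorem exp_ad_apply (a f : B) : exp (ad a) f = exp a * f * exp (-a) := by
  have hL : ∀ a f : B, exp (ContinuousLinearMap.mul ℝ B a) f = exp a * f := by
    intro a f
    rw [← ent_one_eq_exp, ← ent_one_eq_exp]
    refine (hasSum_ent_apply abs_one_le _ f).unique ?_
    have e : ∀ n : ℕ, ((ContinuousLinearMap.mul ℝ B a) ^ n) f = a ^ n * f := by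
      intro n
      induction n with
      | zero => simp
      | succ n ih => rw [pow_succ', mul_apply_eq_comp, ih]; simp [pow_succ', mul_assoc]
    simpa only [e, smul_mul_assoc] using (hasSum_ent abs_one_le a).mul_right f
  have hR : ∀ a f : B, exp ((ContinuousLinearMap.mul ℝ B).flip a) f = f * exp a := by
    intro a f
    rw [← ent_one_eq_exp, ← ent_one_eq_exp]
    refine (hasSum_ent_apply abs_one_le _ f).unique ?_
    have e : ∀ n : ℕ, ((ContinuousLinearMap.mul ℝ B).flip a ^ n) f = f * a ^ n := by
      intro n
      induction n with
      | zero => simp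
      | succ n ih => rw [pow_succ', mul_apply_eq_comp, ih]; simp [pow_succ, mul_assoc]
    simpa only [e, mul_smul_comm] using (hasSum_ent abs_one_le a).mul_left f
  have : (ad a : B →L[ℝ] B) =
      ContinuousLinearMap.mul ℝ B a + (ContinuousLinearMap.mul ℝ B).flip (-a) := by
    ext f; simp [ad_apply, sub_eq_add_neg]
  rw [this, exp_add_of_comm, mul_apply_eq_comp, hR, hL, mul_assoc]
  ext f
  simp [mul_assoc]

theorem exp_smul_add_smul (a : B) (s : ℝ) : exp (s • a) * exp ((1 - s) • a) = exp a := by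
  rw [← exp_add_of_comm (((Commute.refl a).smul_left s).smul_right (1 - s)), ← add_smul]
  simp

theorem exp_sub_exp_eq_integral (P Q : B) :
    exp P - exp Q = ∫ s in (0 : ℝ)..1, exp (s • P) * (P - Q) * exp ((1 - s) • Q) := by
  have hd : ∀ s : ℝ, HasDerivAt (fun s : ℝ => exp (s • P) * exp ((1 - s) • Q))
      (exp (s • P) * (P - Q) * exp ((1 - s) • Q)) s := by
    intro s
    have h1 := hasDerivAt_exp_smul_const (𝕂 := ℝ) P s
    have h2 := (hasDerivAt_exp_smul_const' (𝕂 := ℝ) Q (1 - s)).scomp s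
      ((hasDerivAt_id s).const_sub 1)
    refine (h1.mul h2).congr_deriv ?_
    simp only [Function.comp_apply, neg_smul, one_smul, mul_neg]
    noncomm_ring
  have hc : Continuous fun s : ℝ => exp (s • P) * (P - Q) * exp ((1 - s) • Q) := by
    have := continuous_exp (B := B)
    fun_prop
  rw [intervalIntegral.integral_eq_sub_of_hasDerivAt (fun s _ => hd s) (hc.intervalIntegrable _ _)]
  simp

theorem integral_exp_smul_apply {E : Type*} [NormedAddCommGroup E] [NormedSpace ℝ E]
    [CompleteSpace E] (Q : E →L[ℝ] E) (f : E) :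
    ∫ s in (0 : ℝ)..1, exp (s • Q) f = ent cphi Q f := by
  have h := intervalIntegral.hasSum_integral_of_dominated_convergence (a := 0) (b := 1)
    (μ := MeasureTheory.volume)
    (F := fun (n : ℕ) (s : ℝ) => (1 / n ! : ℝ) • ((s • Q) ^ n) f)
    (f := fun s => exp (s • Q) f)
    (fun n _ => ‖(1 / n ! : ℝ) • Q ^ n‖ * ‖f‖) (fun n => by
      refine Continuous.aestronglyMeasurable ?_
      simp only [smul_pow]
      fun_prop) (fun n => by
      refine Eventually.of_forall fun s hs => ?_
      rw [Set.uIoc_of_le zero_le_one] at hs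
      rw [smul_pow, smul_apply, smul_comm, norm_smul,
        ← smul_apply]
      refine (mul_le_of_le_one_left (norm_nonneg _) ?_).trans (ContinuousLinearMap.le_opNorm _ _)
      rw [norm_pow, Real.norm_of_nonneg hs.1.le]
      exact pow_le_one₀ hs.1.le hs.2) (Eventually.of_forall fun s _ =>
        (summable_norm_ent abs_one_le Q).mul_right _) (by simp) (Eventually.of_forall fun s _ => by
        rw [← ent_one_eq_exp]
        exact hasSum_ent_apply abs_one_le _ _)
  refine h.unique ?_
  convert hasSum_ent_apply abs_cphi_le Q f using 2 with n
  simp only [smul_pow, smul_apply]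
  rw [intervalIntegral.integral_smul, intervalIntegral.integral_smul_const, integral_pow, smul_smul]
  congr 1
  simp [cphi]
  field_simp

theorem integral_exp_mul_exp (Q h : B) :
    ∫ s in (0 : ℝ)..1, exp (s • Q) * h * exp ((1 - s) • Q) = ent cphi (ad Q) h * exp Q := by
  rw [← integral_exp_smul_apply]
  change _ = (ContinuousLinearMap.mul ℝ B).flip (exp Q) (∫ s in (0 : ℝ)..1, exp (s • ad Q) h)
  have hc : Continuous fun s : ℝ => exp (s • ad Q) h := by
    have := continuous_exp (B := B →L[ℝ] B)
    fun_prop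
  rw [← ContinuousLinearMap.intervalIntegral_comp_comm _ (hc.intervalIntegrable _ _)]
  refine intervalIntegral.integral_congr fun s _ => ?_
  simp only [ContinuousLinearMap.flip_apply, ContinuousLinearMap.mul_apply']
  rw [← map_smul, exp_ad_apply, ← exp_smul_add_smul Q s]
  rw [mul_assoc (exp (s • Q) * h), ← mul_assoc (exp (-_)), exp_neg_mul_exp, one_mul]

/-- The derivative of the exponential of a curve. -/
theorem hasDerivAt_exp_comp {R : ℝ → B} {R' : B} {t : ℝ} (hR : HasDerivAt R R' t) :
    HasDerivAt (fun t => exp (R t)) (ent cphi (ad (R t)) R' * exp (R t)) t := by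
  rw [hasDerivAt_iff_tendsto_slope, ← integral_exp_mul_exp]
  set Q := R t with hQ
  have hG : Continuous fun p : B × B =>
      ∫ s in (0 : ℝ)..1, exp (s • p.1) * p.2 * exp ((1 - s) • Q) := by
    refine intervalIntegral.continuous_parametric_intervalIntegral_of_continuous ?_
      continuous_const
    have := continuous_exp (B := B)
    fun_prop
  have hl : Tendsto (fun u => (R u, slope R t u)) (𝓝[≠] t) (𝓝 (Q, R')) :=
    (hR.continuousAt.tendsto.mono_left nhdsWithin_le_nhds).prodMk_nhds
      (hasDerivAt_iff_tendsto_slope.1 hR)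
  refine ((hG.tendsto (Q, R')).comp hl).congr fun u => ?_
  simp only [Function.comp_apply, slope, vsub_eq_sub]
  rw [exp_sub_exp_eq_integral, ← intervalIntegral.integral_smul]
  simp [hQ]

theorem hasDerivAt_exp_neg_comp {R : ℝ → B} {R' : B} {t : ℝ} (hR : HasDerivAt R R' t) :
    HasDerivAt (fun t => exp (-R t)) (-(exp (-R t) * ent cphi (ad (R t)) R')) t := by
  have h1 := hasDerivAt_exp_comp hR
  have h2 := hasDerivAt_exp_comp hR.neg
  have h3 := h1.mul h2
  simp only [Pi.neg_apply] at h3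
  have h4 : HasDerivAt (fun t => exp (R t) * exp (-R t)) 0 t := by
    simp only [exp_mul_exp_neg]; exact hasDerivAt_const _ _
  have h5 := h3.unique h4
  refine h2.congr_deriv ?_
  simp only [Pi.neg_apply]
  have h6 := congrArg (exp (-R t) * ·) h5
  simp only [mul_add, ← mul_assoc, exp_neg_mul_exp, one_mul, mul_zero] at h6
  rw [mul_assoc _ (exp (R t)), exp_mul_exp_neg, mul_one] at h6
  rw [eq_neg_iff_add_eq_zero, add_comm, h6]

end Ad

/-! ### The logarithm -/

section Log

variable {B : Type*} [NormedRing B] [NormedAlgebra ℝ B]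

/-- The logarithm series of a real Banach algebra. -/
def rlog (b : B) : B := ∑' n : ℕ, ((-1 : ℝ) ^ n / ((n : ℝ) + 1)) • (b - 1) ^ (n + 1)

omit [NormedAlgebra ℝ B] in
theorem norm_pow_mul_le {a w : B} {ρ : ℝ} (ha : ‖a‖ ≤ ρ) (n : ℕ) : ‖a ^ n * w‖ ≤ ρ ^ n * ‖w‖ := by
  induction n with
  | zero => simp
  | succ n ih =>
    rw [pow_succ', mul_assoc, pow_succ', mul_assoc]
    exact (norm_mul_le _ _).trans
      (mul_le_mul ha ih (norm_nonneg _) ((norm_nonneg _).trans ha))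

theorem hasDerivAt_pow_of_commute {a : ℝ → B} {a' : B} {t : ℝ} (ha : HasDerivAt a a' t)
    (hc : Commute (a t) a') (n : ℕ) :
    HasDerivAt (fun t => a t ^ (n + 1)) (((n : ℝ) + 1) • (a t ^ n * a')) t := by
  induction n with
  | zero => simpa using ha
  | succ n ih =>
    have h := ih.mul ha
    simp only [pow_succ _ (n + 1)]
    refine h.congr_deriv ?_
    push_cast
    rw [smul_mul_assoc, mul_assoc, ← hc.eq, ← mul_assoc, ← pow_succ]
    module

variable [CompleteSpace B]

theorem norm_exp_sub_one_le (x : B) : ‖exp x - 1‖ ≤ Real.exp ‖x‖ - 1 := by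
  have h1 : HasSum (fun n : ℕ => (1 / (n + 1)! : ℝ) • x ^ (n + 1)) (exp x - 1) := by
    have := (hasSum_nat_add_iff' 1).2 (hasSum_ent abs_one_le x)
    simpa [ent_one_eq_exp] using this
  have h2 : HasSum (fun n : ℕ => (1 / (n + 1)! : ℝ) • ‖x‖ ^ (n + 1)) (Real.exp ‖x‖ - 1) := by
    have := (hasSum_nat_add_iff' 1).2 (hasSum_ent abs_one_le ‖x‖)
    simpa [ent_one_eq_exp, Real.exp_eq_exp_ℝ] using this
  rw [← h1.tsum_eq]
  refine tsum_of_norm_bounded h2 fun n => ?_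
  rw [norm_smul, Real.norm_of_nonneg (by positivity), smul_eq_mul]
  gcongr
  exact norm_pow_le' x n.succ_pos

theorem differentiableAt_rlog {b : B} (hb : ‖b - 1‖ < 1) : DifferentiableAt ℝ rlog b := by
  set c : ℕ → ℝ := fun n => (-1) ^ (n + 1) / n with hc
  set p := FormalMultilinearSeries.ofScalars B c with hp
  have hr : 1 ≤ p.radius := by
    refine p.le_radius_of_bound 1 (r := 1) fun n => ?_
    rw [NNReal.coe_one, one_pow, mul_one]
    rcases Nat.eq_zero_or_pos n with rfl | hn
    · have : p 0 = 0 := FormalMultilinearSeries.ofScalars_eq_zero_of_scalar_zero (E := B) (c := c)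
        (n := 0) (by simp [hc])
      simp [this]
    · refine (FormalMultilinearSeries.ofScalars_norm_le _ _ n hn).trans ?_
      rw [hc, Real.norm_eq_abs, abs_div, abs_pow, abs_neg, abs_one, one_pow, Nat.abs_cast]
      exact div_le_one_of_le₀ (by exact_mod_cast hn) (by positivity)
  have h := (p.hasFPowerSeriesOnBall (lt_of_lt_of_le one_pos hr)).mono one_pos hr
  have hs : ∀ a : B, ‖a‖ < 1 → p.sum a = rlog (1 + a) := by
    intro a ha
    have h1 := h.hasSum (y := a) (by simpa [← ofReal_norm] using ha)
    have h2 := (hasSum_nat_add_iff' 1).2 h1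
    rw [zero_add] at h2
    simp only [hp, hc, FormalMultilinearSeries.ofScalars_apply_eq, Finset.sum_range_one] at h2
    rw [rlog, ← sub_eq_zero]
    simp at h2
    rw [sub_eq_zero, add_sub_cancel_left, ← h2.tsum_eq]
    refine tsum_congr fun n => ?_
    congr 1
    ring
  have h3 : DifferentiableAt ℝ p.sum (b - 1) :=
    (h.analyticAt_of_mem (by simpa [← ofReal_norm] using hb)).differentiableAt
  have h4 : DifferentiableAt ℝ (fun b : B => p.sum (b - 1)) b :=
    h3.comp b (differentiableAt_id.sub_const 1)
  refine h4.congr_of_eventuallyEq ?_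
  have : ∀ᶠ b' in 𝓝 b, ‖b' - 1‖ < 1 :=
    (continuous_id.sub continuous_const).norm.continuousAt.eventually_lt continuousAt_const hb
  filter_upwards [this] with b' hb'
  rw [hs _ hb', add_sub_cancel]

omit [CompleteSpace B] in
theorem rlog_one : rlog (1 : B) = 0 := by simp [rlog]

theorem rlog_exp {z : B} (hz : ‖z‖ < Real.log 2) : rlog (exp z) = z := by
  rcases eq_or_ne z 0 with rfl | hz0
  · rw [exp_zero, rlog_one]
  obtain ⟨m, hm1, hm2⟩ := exists_between hz
  have hzp : 0 < ‖z‖ := norm_pos_iff.2 hz0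
  set ρ := Real.exp m - 1 with hρ
  have hρ1 : ρ < 1 := by
    have := Real.exp_lt_exp.2 hm2
    rw [Real.exp_log two_pos] at this
    linarith
  have hρ0 : 0 ≤ ρ := by
    have := Real.add_one_le_exp m
    linarith
  set t : Set ℝ := Metric.ball 0 (m / ‖z‖) with ht
  have hb : ∀ s ∈ t, ‖exp (s • z) - 1‖ ≤ ρ := by
    intro s hs
    refine (norm_exp_sub_one_le _).trans (sub_le_sub_right (Real.exp_le_exp.2 ?_) _)
    rw [ht, mem_ball_zero_iff, lt_div_iff₀ hzp] at hs
    rw [norm_smul]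
    exact hs.le
  have hd : ∀ s ∈ t, HasDerivAt (fun s : ℝ => rlog (exp (s • z))) z s := by
    intro s hs
    have key := hasDerivAt_tsum_of_isPreconnected (𝕜 := ℝ)
      (g := fun (n : ℕ) (s : ℝ) => ((-1 : ℝ) ^ n / ((n : ℝ) + 1)) • (exp (s • z) - 1) ^ (n + 1))
      (g' := fun (n : ℕ) (s : ℝ) => (-(exp (s • z) - 1)) ^ n * (exp (s • z) * z))
      (t := t) (y₀ := 0) (y := s) (u := fun n => ρ ^ n * ((1 + ‖(1 : B)‖) * ‖z‖))
      ((summable_geometric_of_lt_one hρ0 hρ1).mul_right _) Metric.isOpen_ball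
      (convex_ball _ _).isPreconnected ?_ ?_ ?_ ?_ hs
    · refine key.congr_deriv ?_
      have hlt : ‖-(exp (s • z) - 1)‖ < 1 := by rw [norm_neg]; exact (hb s hs).trans_lt hρ1
      have h1 := (summable_geometric_of_norm_lt_one hlt).tsum_mul_right (exp (s • z) * z)
      rw [h1, ← mul_assoc]
      have h2 := geom_series_mul_neg (-(exp (s • z) - 1)) hlt
      rw [sub_neg_eq_add, add_sub_cancel] at h2
      rw [h2, one_mul]
    · intro n s _
      have h1 := (hasDerivAt_exp_smul_const (𝕂 := ℝ) z s).sub_const 1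
      have hcz : Commute (exp (s • z)) z :=
        Commute.exp_left ((Commute.refl z).smul_left s)
      have h2 := (hasDerivAt_pow_of_commute h1 (by
        have : Commute (exp (s • z)) (exp (s • z) * z) := (Commute.refl _).mul_right hcz
        exact this.sub_left (Commute.one_left _)) n).const_smul ((-1 : ℝ) ^ n / ((n : ℝ) + 1))
      refine h2.congr_deriv ?_
      rw [smul_smul, div_mul_cancel₀ _ (by positivity), neg_pow (exp (s • z) - 1), ← smul_mul_assoc]
      congr 1
      rcases Nat.even_or_odd n with h' | h' <;> simp [h', Odd.neg_one_pow]
    · intro n s hs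
      refine (norm_pow_mul_le (ρ := ρ) ((norm_neg _).trans_le (hb s hs)) n).trans ?_
      refine mul_le_mul_of_nonneg_left ((norm_mul_le _ _).trans ?_) (pow_nonneg hρ0 n)
      refine mul_le_mul_of_nonneg_right ?_ (norm_nonneg _)
      have := norm_add_le (exp (s • z) - 1) 1
      rw [sub_add_cancel] at this
      linarith [hb s hs]
    · exact Metric.mem_ball_self (div_pos (hzp.trans hm1) hzp)
    · simp only [zero_smul, exp_zero, sub_self]
      simp
  have h1 : (1 : ℝ) ∈ t := by
    rw [ht, mem_ball_zero_iff, norm_one, lt_div_iff₀ hzp, one_mul]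
    exact hm1
  have h0 : (0 : ℝ) ∈ t := Metric.mem_ball_self (div_pos (hzp.trans hm1) hzp)
  have hd2 : ∀ s ∈ t, HasDerivAt (fun s : ℝ => rlog (exp (s • z)) - s • z) 0 s := by
    intro s hs
    refine ((hd s hs).sub ((hasDerivAt_id s).smul_const z)).congr_deriv ?_
    rw [one_smul, sub_self]
  have h3 := Metric.isOpen_ball.is_const_of_deriv_eq_zero
    ((convex_ball (0 : ℝ) (m / ‖z‖)).isPreconnected)
    (fun s hs => (hd2 s hs).differentiableAt.differentiableWithinAt)
    (fun s hs => (hd2 s hs).deriv) h1 h0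
  simpa [exp_zero, rlog_one, sub_eq_zero] using h3

end Log

/-! ### A fixed point theorem -/

theorem exists_fixedPoint {E : Type*} [NormedAddCommGroup E] [NormedSpace ℝ E] [CompleteSpace E]
    {Ψ : ℝ × E → E} (hΨ : ContDiffAt ℝ 1 Ψ 0) (h0 : ∀ e, Ψ (0, e) = 0) {G : ℝ × E → Prop}
    (hG : ∀ᶠ p in 𝓝 0, G p) {L : Set E} (hLc : IsClosed L) (hL0 : (0 : E) ∈ L)
    (hL : ∀ r e, G (r, e) → e ∈ L → Ψ (r, e) ∈ L) :
    ∃ r > 0, ∃ e ∈ L, G (r, e) ∧ Ψ (r, e) = e := by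
  have hs := hΨ.hasStrictFDerivAt one_ne_zero
  set D := fderiv ℝ Ψ 0 with hD
  have hD0 : ∀ e, D (0, e) = 0 := by
    intro e
    have h1 : HasFDerivAt (fun e : E => ((0 : ℝ), e)) (ContinuousLinearMap.inr ℝ ℝ E) 0 :=
      (ContinuousLinearMap.inr ℝ ℝ E).hasFDerivAt
    have h2 : HasFDerivAt (fun e : E => Ψ (0, e)) (D.comp (ContinuousLinearMap.inr ℝ ℝ E)) 0 :=
      HasFDerivAt.comp (0 : E) (g := Ψ) hs.hasFDerivAt h1
    simp only [h0] at h2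
    have h3 := h2.unique (hasFDerivAt_const (0 : E) (0 : E))
    simpa using DFunLike.congr_fun h3 e
  obtain ⟨s, hs0, happ⟩ := hs.approximates_deriv_on_nhds (c := 1 / 2) (Or.inr (by norm_num))
  obtain ⟨δ, hδ, hball⟩ := Metric.nhds_basis_closedBall.mem_iff.1 (inter_mem hs0 hG)
  have hcont : Tendsto (fun r : ℝ => ‖Ψ (r, 0)‖) (𝓝 0) (𝓝 0) := by
    have h1 : Tendsto (fun r : ℝ => (r, (0 : E))) (𝓝 0) (𝓝 0) :=
      (Continuous.prodMk_left (0 : E)).tendsto 0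
    have h2 := (hΨ.continuousAt.tendsto.comp h1).norm
    rwa [show Ψ 0 = 0 from h0 0, norm_zero] at h2
  have hev : ∀ᶠ r : ℝ in 𝓝[>] 0, ‖Ψ (r, 0)‖ < δ / 2 ∧ |r| < δ ∧ 0 < r := by
    have h1 := hcont.eventually (gt_mem_nhds (half_pos hδ))
    have h2 : ∀ᶠ r : ℝ in 𝓝 0, |r| < δ :=
      (continuous_abs.tendsto' (0 : ℝ) 0 abs_zero).eventually (gt_mem_nhds hδ)
    filter_upwards [nhdsWithin_le_nhds h1, nhdsWithin_le_nhds h2, self_mem_nhdsWithin]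
      with r h1 h2 h3 using ⟨h1, h2, h3⟩
  obtain ⟨r, hr1, hr2, hr3⟩ := hev.exists
  have hmem : ∀ e : E, ‖e‖ ≤ δ → (r, e) ∈ s ∩ {p | G p} := fun e he => hball (by
    rw [mem_closedBall_zero_iff]
    exact max_le (by simpa using hr2.le) he)
  have hlip : ∀ e e' : E, ‖e‖ ≤ δ → ‖e'‖ ≤ δ → ‖Ψ (r, e) - Ψ (r, e')‖ ≤ 1 / 2 * ‖e - e'‖ := by
    intro e e' he he'
    have := happ _ (hmem e he).1 _ (hmem e' he').1
    rw [Prod.mk_sub_mk, sub_self, hD0, sub_zero, Prod.norm_mk, norm_zero,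
      max_eq_right (norm_nonneg _)] at this
    simpa using this
  set K : Set E := Metric.closedBall 0 δ ∩ L with hK
  have hKc : IsComplete K := (Metric.isClosed_closedBall.inter hLc).isComplete
  have hmaps : Set.MapsTo (fun e => Ψ (r, e)) K K := by
    rintro e ⟨he, heL⟩
    rw [mem_closedBall_zero_iff] at he
    refine ⟨?_, hL r e (hmem e he).2 heL⟩
    rw [mem_closedBall_zero_iff]
    have h1 := hlip e 0 he (by simpa using hδ.le)
    have h2 := norm_sub_norm_le (Ψ (r, e)) (Ψ (r, 0))
    rw [sub_zero] at h1
    simp only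
    linarith
  have hcontr : ContractingWith (1 / 2) (hmaps.restrict (fun e => Ψ (r, e)) K K) := by
    refine ⟨by rw [← NNReal.coe_lt_coe]; norm_num, LipschitzWith.of_dist_le_mul fun e e' => ?_⟩
    have := hlip e e' (by simpa using e.2.1) (by simpa using e'.2.1)
    rw [Subtype.dist_eq, Subtype.dist_eq, dist_eq_norm, dist_eq_norm]
    simpa using this
  obtain ⟨e, heK, hfix, -⟩ := hcontr.exists_fixedPoint' hKc hmaps
    (x := 0) ⟨by simpa using hδ.le, hL0⟩ (edist_ne_top _ _)
  exact ⟨r, hr3, e, heK.2, (hmem e (by simpa using heK.1)).2, hfix⟩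

/-! ### Closed Lie subalgebras -/

section Lie

variable {B : Type*} [NormedRing B] [NormedAlgebra ℝ B]

/-- Closed subspaces which are stable under commutators. -/
structure IsClosedLie (S : Submodule ℝ B) : Prop where
  isClosed : IsClosed (S : Set B)
  ad_mem : ∀ a ∈ S, ∀ b ∈ S, ad a b ∈ S

/-- The algebra of the operators that preserve a subspace. -/
def preserving {E : Type*} [NormedAddCommGroup E] [NormedSpace ℝ E] (S : Submodule ℝ E) :
    Subalgebra ℝ (E →L[ℝ] E) where
  carrier := {Q | ∀ f ∈ S, Q f ∈ S}
  mul_mem' hP hQ f hf := hP _ (hQ f hf)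
  add_mem' hP hQ f hf := S.add_mem (hP f hf) (hQ f hf)
  algebraMap_mem' r f hf := by
    rw [Algebra.algebraMap_eq_smul_one]
    exact S.smul_mem r hf

theorem isClosed_preserving {E : Type*} [NormedAddCommGroup E] [NormedSpace ℝ E]
    {S : Submodule ℝ E} (hS : IsClosed (S : Set E)) :
    IsClosed (preserving S : Set (E →L[ℝ] E)) := by
  have : (preserving S : Set (E →L[ℝ] E)) = ⋂ f ∈ S, (fun Q : E →L[ℝ] E => Q f) ⁻¹' S := by
    ext Q
    simp only [Set.mem_iInter]
    rfl
  rw [this]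
  exact isClosed_biInter fun f _ => hS.preimage (by fun_prop)

variable [CompleteSpace B]

/-- The value at `f` of an entire function of `ad F`. -/
def opE (c : ℕ → ℝ) (F f : B) : B := ent c (ad F) f

/-- The value at `f` of `z / (eᶻ - 1)` at `ad F`. -/
def opN (F f : B) : B := nu (ad F) f

omit [CompleteSpace B] in
theorem norm_ad_le_half {F : B} (hF : ‖F‖ ≤ 1 / 4) : ‖ad F‖ ≤ 1 / 2 :=
  (norm_ad_le F).trans (by linarith)

theorem IsClosedLie.opE_mem {S : Submodule ℝ B} (hS : IsClosedLie S) {c : ℕ → ℝ}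
    (hc : ∀ n, |c n| ≤ 1) {F f : B} (hF : F ∈ S) (hf : f ∈ S) : opE c F f ∈ S :=
  ent_mem hc (preserving S) (isClosed_preserving hS.isClosed) (a := ad F)
    (fun g hg => hS.ad_mem F hF g hg) f hf

theorem IsClosedLie.opN_mem {S : Submodule ℝ B} (hS : IsClosedLie S) {F f : B}
    (hn : ‖F‖ ≤ 1 / 4) (hF : F ∈ S) (hf : f ∈ S) : opN F f ∈ S :=
  nu_mem (preserving S) (isClosed_preserving hS.isClosed) (a := ad F)
    (fun g hg => hS.ad_mem F hF g hg) (norm_ad_le_half hn) f hf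

theorem opE_one (F f : B) : opE (fun _ => 1) F f = exp F * f * exp (-F) := by
  rw [opE, ent_one_eq_exp, exp_ad_apply]

theorem opE_eq_add {c : ℕ → ℝ} (hc : ∀ n, |c n| ≤ 1) (F f : B) :
    opE c F f = c 0 • f + ad F (opE (shift c) F f) := by
  rw [opE, ent_eq_add_mul hc]
  rfl

theorem opE_phi_opN {F : B} (hF : ‖F‖ ≤ 1 / 4) (f : B) : opE cphi F (opN F f) = f := by
  rw [opE, opN, ← mul_apply_eq_comp, phi_mul_nu (norm_ad_le_half hF)]
  rfl

theorem opN_opE_phi {F : B} (hF : ‖F‖ ≤ 1 / 4) (f : B) : opN F (opE cphi F f) = f := by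
  rw [opE, opN, ← mul_apply_eq_comp, nu_mul_phi (norm_ad_le_half hF)]
  rfl

theorem opN_eq_add {F : B} (hF : ‖F‖ ≤ 1 / 4) (f : B) :
    opN F f = f - ad F (opE (shift cphi) F (opN F f)) := by
  have h := opE_phi_opN hF f
  rw [opE_eq_add abs_cphi_le] at h
  rw [eq_sub_iff_add_eq]
  simpa [cphi] using h

variable {X : Type*} [NormedAddCommGroup X] [NormedSpace ℝ X]

theorem contDiffAt_opE {c : ℕ → ℝ} (hc : ∀ n, |c n| ≤ 1) {F f : X → B}
    (hF : ContDiffAt ℝ 1 F 0) (hF0 : F 0 = 0) (hf : ContDiffAt ℝ 1 f 0) :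
    ContDiffAt ℝ 1 (fun p => opE c (F p) (f p)) 0 := by
  have h1 : ContDiffAt ℝ 1 (fun p => (ad (F p) : B →L[ℝ] B)) 0 :=
    (ContinuousLinearMap.contDiff (ad (B := B))).contDiffAt.comp (0 : X) hF
  have h2 : ContDiffAt ℝ 1 (fun p => ent c (ad (F p) : B →L[ℝ] B)) 0 := by
    refine ContDiffAt.comp 0 (g := ent c) ?_ h1
    rw [hF0, map_zero]
    exact contDiffAt_ent hc
  exact h2.clm_apply hf

theorem contDiffAt_opN {F f : X → B}
    (hF : ContDiffAt ℝ 1 F 0) (hF0 : F 0 = 0) (hf : ContDiffAt ℝ 1 f 0) :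
    ContDiffAt ℝ 1 (fun p => opN (F p) (f p)) 0 := by
  have h1 : ContDiffAt ℝ 1 (fun p => (ad (F p) : B →L[ℝ] B)) 0 :=
    (ContinuousLinearMap.contDiff (ad (B := B))).contDiffAt.comp (0 : X) hF
  have h2 : ContDiffAt ℝ 1 (fun p => nu (ad (F p) : B →L[ℝ] B)) 0 := by
    refine ContDiffAt.comp 0 (g := nu) ?_ h1
    rw [hF0, map_zero]
    exact contDiffAt_nu
  exact h2.clm_apply hf

end Lie

/-! ### Functions on the square -/

/-- The unit square. -/
abbrev Sq : Type := unitInterval × unitInterval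

section Square

variable {B : Type*} [NormedRing B] [NormedAlgebra ℝ B] [CompleteSpace B]

/-- `F ↦ ∫ σ in 0..u p, F (k (p, σ))`. -/
def intOp (u : C(Sq, ℝ)) (hu : ∀ p, u p ∈ unitInterval) (k : C(Sq × ℝ, Sq)) :
    C(Sq, B) →L[ℝ] C(Sq, B) :=
  LinearMap.mkContinuous
    { toFun := fun F => ⟨fun p => ∫ σ in (0 : ℝ)..u p, F (k (p, σ)),
        intervalIntegral.continuous_parametric_intervalIntegral_of_continuous
          (f := fun p σ => F (k (p, σ))) (by fun_prop) u.continuous⟩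
      map_add' := fun F G => by
        ext p
        exact intervalIntegral.integral_add
          (Continuous.intervalIntegrable (by fun_prop) _ _)
          (Continuous.intervalIntegrable (by fun_prop) _ _)
      map_smul' := fun c F => by
        ext p
        exact intervalIntegral.integral_smul c _ } 1
    (fun F => by
      rw [one_mul, ContinuousMap.norm_le _ (norm_nonneg _)]
      intro p
      refine (intervalIntegral.norm_integral_le_of_norm_le_const
        (C := ‖F‖) fun σ _ => F.norm_coe_le_norm _).trans ?_
      rw [sub_zero, abs_of_nonneg (hu p).1]
      exact mul_le_of_le_one_right (norm_nonneg _) (hu p).2)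

omit [CompleteSpace B] in
theorem intOp_apply (u : C(Sq, ℝ)) (hu : ∀ p, u p ∈ unitInterval) (k : C(Sq × ℝ, Sq))
    (F : C(Sq, B)) (p : Sq) : intOp u hu k F p = ∫ σ in (0 : ℝ)..u p, F (k (p, σ)) := rfl

/-- The projection of the line to the unit interval. -/
def projI : C(ℝ, unitInterval) := ⟨Set.projIcc 0 1 zero_le_one, continuous_projIcc⟩

theorem projI_coe (s : unitInterval) : projI s = s := Set.projIcc_val zero_le_one s

/-- Integration over `[0, t]` in the first variable. -/
def opJ : C(Sq, B) →L[ℝ] C(Sq, B) :=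
  intOp ⟨fun p => (p.1 : ℝ), by fun_prop⟩ (fun p => p.1.2)
    ⟨fun q => (projI q.2, q.1.2), by fun_prop⟩

/-- Integration over `[0, s]` in the second variable. -/
def opK : C(Sq, B) →L[ℝ] C(Sq, B) :=
  intOp ⟨fun p => (p.2 : ℝ), by fun_prop⟩ (fun p => p.2.2)
    ⟨fun q => (q.1.1, projI q.2), by fun_prop⟩

/-- Integration over `[0, 1]` in the second variable. -/
def opP : C(Sq, B) →L[ℝ] C(Sq, B) :=
  intOp ⟨fun _ => 1, by fun_prop⟩ (fun _ => ⟨zero_le_one, le_rfl⟩)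
    ⟨fun q => (q.1.1, projI q.2), by fun_prop⟩

omit [CompleteSpace B] in
theorem opJ_apply (F : C(Sq, B)) (p : Sq) :
    opJ F p = ∫ τ in (0 : ℝ)..p.1, F (projI τ, p.2) := rfl

omit [CompleteSpace B] in
theorem opK_apply (F : C(Sq, B)) (p : Sq) :
    opK F p = ∫ σ in (0 : ℝ)..p.2, F (p.1, projI σ) := rfl

omit [CompleteSpace B] in
theorem opP_apply (F : C(Sq, B)) (p : Sq) :
    opP F p = ∫ σ in (0 : ℝ)..1, F (p.1, projI σ) := rfl

/-- The first coordinate. -/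
def tt : C(Sq, B) := ⟨fun p => (p.1 : ℝ) • 1, by fun_prop⟩

/-- The second coordinate. -/
def ss : C(Sq, B) := ⟨fun p => (p.2 : ℝ) • 1, by fun_prop⟩

omit [CompleteSpace B] in
theorem tt_mul_apply (F : C(Sq, B)) (p : Sq) : (tt * F : C(Sq, B)) p = (p.1 : ℝ) • F p := by
  simp [tt]

omit [CompleteSpace B] in
theorem ss_mul_apply (F : C(Sq, B)) (p : Sq) : (ss * F : C(Sq, B)) p = (p.2 : ℝ) • F p := by
  simp [ss]

omit [CompleteSpace B] in
theorem norm_tt_mul_le (F : C(Sq, B)) : ‖tt * F‖ ≤ ‖F‖ := by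
  rw [ContinuousMap.norm_le _ (norm_nonneg _)]
  intro p
  rw [tt_mul_apply, norm_smul, Real.norm_of_nonneg p.1.2.1]
  exact (mul_le_of_le_one_left (norm_nonneg _) p.1.2.2).trans (F.norm_coe_le_norm p)

/-- The functions with values in a given subspace. -/
def valued (S : Submodule ℝ B) : Submodule ℝ C(Sq, B) where
  carrier := {F | ∀ p, F p ∈ S}
  add_mem' hF hG p := S.add_mem (hF p) (hG p)
  zero_mem' _ := S.zero_mem
  smul_mem' c _ hF p := S.smul_mem c (hF p)

omit [CompleteSpace B] in
theorem IsClosedLie.valued {S : Submodule ℝ B} (hS : IsClosedLie S) : IsClosedLie (valued S) where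
  isClosed := by
    have : (BanachKV.valued S : Set C(Sq, B)) = ⋂ p, (fun F : C(Sq, B) => F p) ⁻¹' S := by
      ext F; simp [BanachKV.valued]
    rw [this]
    exact isClosed_iInter fun p => hS.isClosed.preimage (continuous_eval_const p)
  ad_mem a ha b hb p := hS.ad_mem _ (ha p) _ (hb p)

theorem integral_mem {S : Submodule ℝ B} (hS : IsClosed (S : Set B)) {f : ℝ → B}
    (hf : Continuous f) (h : ∀ σ, f σ ∈ S) (a b : ℝ) : ∫ σ in a..b, f σ ∈ S := by
  have : CompleteSpace S := hS.completeSpace_coe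
  have hc : Continuous fun σ => (⟨f σ, h σ⟩ : S) := hf.subtype_mk h
  have := S.subtypeL.intervalIntegral_comp_comm
    (hc.intervalIntegrable (μ := MeasureTheory.volume) a b)
  simp only [Submodule.subtypeL_apply] at this
  rw [this]
  exact Subtype.coe_prop _

theorem intOp_mem {S : Submodule ℝ B} (hS : IsClosed (S : Set B)) {u : C(Sq, ℝ)}
    {hu : ∀ p, u p ∈ unitInterval} {k : C(Sq × ℝ, Sq)} {F : C(Sq, B)} (hF : F ∈ valued S) :
    intOp u hu k F ∈ valued S := fun _ =>
  integral_mem hS (by fun_prop) (fun _ => hF _) _ _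

omit [CompleteSpace B] in
theorem tt_mul_mem {S : Submodule ℝ B} {F : C(Sq, B)} (hF : F ∈ valued S) :
    tt * F ∈ valued S := fun p => by
  rw [tt_mul_apply]; exact S.smul_mem _ (hF p)

omit [CompleteSpace B] in
theorem ss_mul_mem {S : Submodule ℝ B} {F : C(Sq, B)} (hF : F ∈ valued S) :
    ss * F ∈ valued S := fun p => by
  rw [ss_mul_apply]; exact S.smul_mem _ (hF p)

/-- The functions of the first variable with values in a given subspace. -/
def indep (L : Submodule ℝ B) : Submodule ℝ C(Sq, B) where
  carrier := {F | F ∈ valued L ∧ ∀ t s s', F (t, s) = F (t, s')}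
  add_mem' hF hG := ⟨(valued L).add_mem hF.1 hG.1, fun t s s' =>
    congrArg₂ (· + ·) (hF.2 t s s') (hG.2 t s s')⟩
  zero_mem' := ⟨(valued L).zero_mem, fun _ _ _ => rfl⟩
  smul_mem' c _ hF := ⟨(valued L).smul_mem c hF.1, fun t s s' =>
    congrArg (c • ·) (hF.2 t s s')⟩

omit [CompleteSpace B] in
theorem IsClosedLie.indep {L : Submodule ℝ B} (hL : IsClosedLie L) : IsClosedLie (indep L) where
  isClosed := by
    have : {F : C(Sq, B) | ∀ t s s', F (t, s) = F (t, s')} =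
        ⋂ t, ⋂ s, ⋂ s', {F : C(Sq, B) | F (t, s) = F (t, s')} := by
      ext
      simp only [Set.mem_iInter, Set.mem_ofPred_eq]
    have h : IsClosed {F : C(Sq, B) | ∀ t s s', F (t, s) = F (t, s')} := by
      rw [this]
      exact isClosed_iInter fun t => isClosed_iInter fun s => isClosed_iInter fun s' =>
        isClosed_eq (continuous_eval_const _) (continuous_eval_const _)
    exact hL.valued.isClosed.inter h
  ad_mem a ha b hb := ⟨hL.valued.ad_mem a ha.1 b hb.1, fun t s s' =>
    congrArg₂ (fun u v => ad u v) (ha.2 t s s') (hb.2 t s s')⟩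

theorem opP_mem_indep {L : Submodule ℝ B} (hL : IsClosed (L : Set B)) {F : C(Sq, B)}
    (hF : F ∈ valued L) : opP F ∈ indep L :=
  ⟨intOp_mem hL hF, fun _ _ _ => rfl⟩

theorem opJ_mem_indep {L : Submodule ℝ B} (hL : IsClosed (L : Set B)) {F : C(Sq, B)}
    (hF : F ∈ indep L) : opJ F ∈ indep L := by
  refine ⟨intOp_mem hL hF.1, fun t s s' => ?_⟩
  rw [opJ_apply, opJ_apply]
  simp only [hF.2 _ s s']

theorem opE_apply {c : ℕ → ℝ} (hc : ∀ n, |c n| ≤ 1) (F f : C(Sq, B)) (p : Sq) :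
    opE c F f p = opE c (F p) (f p) :=
  map_ent_apply hc (ContinuousMap.evalCLM ℝ p) (Q := ad F) (Q' := ad (F p)) (fun _ => rfl) f

theorem opE_phi_opN_apply {F : C(Sq, B)} (hF : ‖F‖ ≤ 1 / 4) (f : C(Sq, B)) (p : Sq) :
    opE cphi (F p) (opN F f p) = f p := by
  rw [← opE_apply abs_cphi_le, opE_phi_opN hF]

omit [NormedAlgebra ℝ B] [CompleteSpace B] in
theorem norm_apply_le {F : C(Sq, B)} {δ : ℝ} (hF : ‖F‖ ≤ δ) (p : Sq) : ‖F p‖ ≤ δ :=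
  (F.norm_coe_le_norm p).trans hF

theorem opN_apply {F : C(Sq, B)} (hF : ‖F‖ ≤ 1 / 4) (f : C(Sq, B)) (p : Sq) :
    opN F f p = opN (F p) (f p) := by
  rw [← opE_phi_opN_apply hF f p, opN_opE_phi (norm_apply_le hF p)]

end Square

/-! ### The integral equations of the flow -/

section Beta

variable {B : Type*} [NormedRing B] [NormedAlgebra ℝ B] [CompleteSpace B]

/-- `exp (ad F) f = e^F f e^{-F}`. -/
def opC (F f : B) : B := opE (fun _ => 1) F f

theorem opC_eq (F f : B) : opC F f = exp F * f * exp (-F) := opE_one F f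

/-- `z / (1 - e^{-z})` at `z = ad F`. -/
def opBeta (F f : B) : B := opC F (opN F f)

/-- `(z / (1 - e^{-z}) - 1) / (1 - eᶻ)` at `z = ad F`. -/
def opKappa (F f : B) : B := -opE ceta F (opN F (opN F f))

theorem opBeta_sub_self {F : B} (hF : ‖F‖ ≤ 1 / 4) (f : B) :
    opBeta F f - f = opKappa F f - opC F (opKappa F f) := by
  set z : B →L[ℝ] B := ad F with hz
  have h1 : ent (fun _ => 1) z = 1 + z * ent cphi z := by
    rw [ent_one_eq_exp, exp_eq_one_add_mul_phi]
  have h2 : ent (fun _ => 1) z = ent cphi z + z * ent ceta z := by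
    rw [ent_one_eq_exp, exp_eq_phi_add_mul_eta]
  have h3 : ent cphi z * nu z = 1 := phi_mul_nu (norm_ad_le_half hF)
  have h4 : ent cphi z * ent ceta z = ent ceta z * ent cphi z :=
    (Commute.ent_left abs_cphi_le (Commute.ent_left abs_ceta_le (Commute.refl z)).symm).eq
  have h5 : ent (fun _ => 1) z * nu z - 1 =
      -(ent ceta z * (nu z * nu z)) - ent (fun _ => 1) z * -(ent ceta z * (nu z * nu z)) := by
    have h6 : ent (fun _ => 1) z * nu z - 1 = z * ent ceta z * nu z := by
      rw [h2, add_mul, h3, add_sub_cancel_left]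
    have h7 : ent cphi z * (ent ceta z * (nu z * nu z)) = ent ceta z * nu z := by
      rw [← mul_assoc, h4, mul_assoc, ← mul_assoc (ent cphi z), h3, one_mul]
    rw [h6, h1, add_mul, one_mul, mul_neg (z * _), mul_assoc z (ent cphi z), h7]
    noncomm_ring
  exact DFunLike.congr_fun h5 f

theorem phi_opBeta {F : B} (hF : ‖F‖ ≤ 1 / 4) (f : B) : opE cphi F (opBeta F f) = opC F f := by
  have h : ent cphi (ad F : B →L[ℝ] B) * ent (fun _ => 1) (ad F) =
      ent (fun _ => 1) (ad F) * ent cphi (ad F) :=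
    (Commute.ent_left abs_cphi_le (Commute.ent_left abs_one_le (Commute.refl _)).symm).eq
  have h1 := DFunLike.congr_fun h (opN F f)
  simp only [mul_apply_eq_comp] at h1
  exact h1.trans (congrArg _ (opE_phi_opN hF f))

theorem IsClosedLie.opC_mem {L : Submodule ℝ B} (hL : IsClosedLie L) {F f : B} (hF : F ∈ L)
    (hf : f ∈ L) : opC F f ∈ L := hL.opE_mem abs_one_le hF hf

theorem IsClosedLie.opBeta_mem {L : Submodule ℝ B} (hL : IsClosedLie L) {F f : B}
    (hn : ‖F‖ ≤ 1 / 4) (hF : F ∈ L) (hf : f ∈ L) : opBeta F f ∈ L :=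
  hL.opC_mem hF (hL.opN_mem hn hF hf)

theorem IsClosedLie.opKappa_mem {L : Submodule ℝ B} (hL : IsClosedLie L) {F f : B}
    (hn : ‖F‖ ≤ 1 / 4) (hF : F ∈ L) (hf : f ∈ L) : opKappa F f ∈ L :=
  L.neg_mem (hL.opE_mem abs_ceta_le hF (hL.opN_mem hn hF (hL.opN_mem hn hF hf)))

end Beta

section System

variable {B : Type*} [NormedRing B] [NormedAlgebra ℝ B] [CompleteSpace B]

/-- The end point `log (e^{tU} e^{tW}) / t` of the path `V`. -/
def endV (U W V : C(Sq, B)) : C(Sq, B) := U + opP (opBeta (tt * V) W)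

/-- The logarithmic derivative of the first conjugating curve. -/
def coefA (U W V : C(Sq, B)) : C(Sq, B) :=
  W + opP (opKappa (tt * V) W) - (1 / 4 : ℝ) • endV U W V + (1 / 4 : ℝ) • U

/-- The logarithmic derivative of the second conjugating curve. -/
def coefB (U W V : C(Sq, B)) : C(Sq, B) :=
  opN (tt * W) (opP (ss * opE cphi (ss * (tt * W)) (opKappa (tt * V) W)))
    - (1 / 4 : ℝ) • endV U W V + (1 / 2 : ℝ) • W

/-- A solution of the integral equations of the flow. -/
structure IsFlow (x y R S U W V : C(Sq, B)) : Prop where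
  U_eq : U = opC R x
  W_eq : W = opC S y
  V_eq : V = U + opK (opBeta (tt * V) W)
  R_eq : R = opJ (opN R (coefA U W V))
  S_eq : S = opJ (opN S (coefB U W V))

omit [CompleteSpace B] in
/-- Constant functions. -/
theorem const_mem {L : Submodule ℝ B} {x : B} (hx : x ∈ L) :
    ContinuousMap.const Sq x ∈ indep L := ⟨fun _ => hx, fun _ _ _ => rfl⟩

theorem exists_flow {L : Submodule ℝ B} (hL : IsClosedLie L) {x₀ y₀ : B} (hx : x₀ ∈ L)
    (hy : y₀ ∈ L) {δ : ℝ} (hδ : 0 < δ) (hδ4 : δ ≤ 1 / 4) :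
    ∃ r : ℝ, 0 < r ∧ r ≤ δ ∧ ∃ R S U W V : C(Sq, B),
      IsFlow (r • ContinuousMap.const Sq x₀) (r • ContinuousMap.const Sq y₀) R S U W V ∧
      (R ∈ indep L ∧ S ∈ indep L ∧ U ∈ indep L ∧ W ∈ indep L ∧ V ∈ valued L) ∧
      ‖R‖ ≤ δ ∧ ‖S‖ ≤ δ ∧ ‖U‖ ≤ δ ∧ ‖W‖ ≤ δ ∧ ‖V‖ ≤ δ := by
  set x := ContinuousMap.const Sq x₀
  set y := ContinuousMap.const Sq y₀
  let fr : ℝ × (C(Sq, B) × C(Sq, B) × C(Sq, B)) → ℝ := fun p => p.1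
  let fR : ℝ × (C(Sq, B) × C(Sq, B) × C(Sq, B)) → C(Sq, B) := fun p => p.2.1
  let fS : ℝ × (C(Sq, B) × C(Sq, B) × C(Sq, B)) → C(Sq, B) := fun p => p.2.2.1
  let fV : ℝ × (C(Sq, B) × C(Sq, B) × C(Sq, B)) → C(Sq, B) := fun p => p.2.2.2
  let fU : ℝ × (C(Sq, B) × C(Sq, B) × C(Sq, B)) → C(Sq, B) := fun p => opC (fR p) (fr p • x)
  let fW : ℝ × (C(Sq, B) × C(Sq, B) × C(Sq, B)) → C(Sq, B) := fun p => opC (fS p) (fr p • y)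
  have hr : ContDiffAt ℝ 1 fr 0 := contDiffAt_fst
  have hR : ContDiffAt ℝ 1 fR 0 := contDiff_snd.fst.contDiffAt
  have hS : ContDiffAt ℝ 1 fS 0 := contDiff_snd.snd.fst.contDiffAt
  have hV : ContDiffAt ℝ 1 fV 0 := contDiff_snd.snd.snd.contDiffAt
  have hU : ContDiffAt ℝ 1 fU 0 :=
    contDiffAt_opE abs_one_le hR rfl (hr.smul contDiffAt_const)
  have hW : ContDiffAt ℝ 1 fW 0 :=
    contDiffAt_opE abs_one_le hS rfl (hr.smul contDiffAt_const)
  have hU0 : ∀ e, fU (0, e) = 0 := fun e =>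
    (congrArg (opC (fR (0, e))) (zero_smul ℝ x)).trans (map_zero _)
  have hW0 : ∀ e, fW (0, e) = 0 := fun e =>
    (congrArg (opC (fS (0, e))) (zero_smul ℝ y)).trans (map_zero _)
  have hmul : ∀ (c : C(Sq, B)) {f : ℝ × (C(Sq, B) × C(Sq, B) × C(Sq, B)) → C(Sq, B)},
      ContDiffAt ℝ 1 f 0 → ContDiffAt ℝ 1 (fun p => c * f p) 0 := fun c f hf =>
    contDiffAt_const.mul hf
  have hclm : ∀ (T : C(Sq, B) →L[ℝ] C(Sq, B))
      {f : ℝ × (C(Sq, B) × C(Sq, B) × C(Sq, B)) → C(Sq, B)},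
      ContDiffAt ℝ 1 f 0 → ContDiffAt ℝ 1 (fun p => T (f p)) 0 := fun T f hf =>
    T.contDiff.contDiffAt.comp _ hf
  have htV := hmul tt hV
  have htV0 : tt * fV 0 = 0 := mul_zero _
  have htW := hmul tt hW
  have htW0 : tt * fW 0 = 0 := by rw [show fW 0 = 0 from hW0 0, mul_zero]
  have hB : ContDiffAt ℝ 1 (fun p => opBeta (tt * fV p) (fW p)) 0 :=
    contDiffAt_opE abs_one_le htV htV0 (contDiffAt_opN htV htV0 hW)
  have hK : ContDiffAt ℝ 1 (fun p => opKappa (tt * fV p) (fW p)) 0 :=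
    (contDiffAt_opE abs_ceta_le htV htV0
      (contDiffAt_opN htV htV0 (contDiffAt_opN htV htV0 hW))).neg
  have hE : ContDiffAt ℝ 1 (fun p => endV (fU p) (fW p) (fV p)) 0 := hU.add (hclm opP hB)
  have hcA : ContDiffAt ℝ 1 (fun p => coefA (fU p) (fW p) (fV p)) 0 :=
    ((hW.add (hclm opP hK)).sub (hE.const_smul _)).add (hU.const_smul _)
  have hcB : ContDiffAt ℝ 1 (fun p => coefB (fU p) (fW p) (fV p)) 0 :=
    ((contDiffAt_opN htW htW0 (hclm opP (hmul ss (contDiffAt_opE abs_cphi_le (hmul ss htW)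
      (by rw [htW0, mul_zero]) hK)))).sub (hE.const_smul _)).add (hW.const_smul _)
  let Ψ : ℝ × (C(Sq, B) × C(Sq, B) × C(Sq, B)) → C(Sq, B) × C(Sq, B) × C(Sq, B) := fun p =>
    (opJ (opN (fR p) (coefA (fU p) (fW p) (fV p))),
      opJ (opN (fS p) (coefB (fU p) (fW p) (fV p))),
      fU p + opK (opBeta (tt * fV p) (fW p)))
  have hΨ : ContDiffAt ℝ 1 Ψ 0 :=
    (hclm opJ (contDiffAt_opN hR rfl hcA)).prodMk
      ((hclm opJ (contDiffAt_opN hS rfl hcB)).prodMk (hU.add (hclm opK hB)))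
  have hΨ0 : ∀ e, Ψ (0, e) = 0 := by
    intro e
    have hz : ∀ c : ℝ, c • (0 : C(Sq, B)) = 0 := fun c =>
      ContinuousMap.ext fun _ => smul_zero c
    simp [Ψ, hU0, hW0, coefA, coefB, endV, opBeta, opKappa, opC, opE, opN, hz]
  have hsmall : ∀ {f : ℝ × (C(Sq, B) × C(Sq, B) × C(Sq, B)) → C(Sq, B)},
      ContDiffAt ℝ 1 f 0 → f 0 = 0 → ∀ᶠ p in 𝓝 0, ‖f p‖ ≤ δ := by
    intro f hf hf0
    have h1 := hf.continuousAt.norm.tendsto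
    rw [hf0, norm_zero] at h1
    exact (h1.eventually (gt_mem_nhds hδ)).mono fun _ h => le_of_lt h
  have hrs : ∀ᶠ p in 𝓝 0, fr p ≤ δ :=
    (hr.continuousAt.tendsto.eventually (gt_mem_nhds (show fr 0 < δ from hδ))).mono
      fun _ h => le_of_lt h
  have hG : ∀ᶠ p in 𝓝 0, fr p ≤ δ ∧ ‖fR p‖ ≤ δ ∧ ‖fS p‖ ≤ δ ∧ ‖fU p‖ ≤ δ ∧ ‖fW p‖ ≤ δ ∧
      ‖fV p‖ ≤ δ :=
    hrs.and ((hsmall hR rfl).and ((hsmall hS rfl).and ((hsmall hU (hU0 0)).and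
      ((hsmall hW (hW0 0)).and (hsmall hV rfl)))))
  have hLv := hL.valued
  have hLi := hL.indep
  have hUm : ∀ p, fR p ∈ indep L → fU p ∈ indep L := fun p h =>
    hLi.opC_mem h ((indep L).smul_mem _ (const_mem hx))
  have hWm : ∀ p, fS p ∈ indep L → fW p ∈ indep L := fun p h =>
    hLi.opC_mem h ((indep L).smul_mem _ (const_mem hy))
  obtain ⟨r, hr0, ⟨R, S, V⟩, ⟨hRm, hSm, hVm⟩, ⟨hg1, hg2, hg3, hg4, hg5, hg6⟩, hfix⟩ :=
    exists_fixedPoint (Ψ := Ψ) hΨ hΨ0 hG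
      (L := {e | e.1 ∈ indep L ∧ e.2.1 ∈ indep L ∧ e.2.2 ∈ valued L})
      ((hLi.isClosed.preimage continuous_fst).inter
        ((hLi.isClosed.preimage (continuous_fst.comp continuous_snd)).inter
          (hLv.isClosed.preimage (continuous_snd.comp continuous_snd))))
      ⟨(indep L).zero_mem, (indep L).zero_mem, (valued L).zero_mem⟩ (by
        rintro r ⟨R, S, V⟩ ⟨h1, h2, h3, h4, h5, h6⟩ ⟨hRm, hSm, hVm⟩
        have hU := hUm (r, R, S, V) hRm
        have hW := hWm (r, R, S, V) hSm
        have htV := tt_mul_mem hVm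
        have htW := tt_mul_mem hW.1
        have htWi : tt * fW (r, R, S, V) ∈ indep L := ⟨htW, fun t s s' => by
          rw [tt_mul_apply, tt_mul_apply, hW.2 t s s']⟩
        have hnV := (norm_tt_mul_le (fV (r, R, S, V))).trans (h6.trans hδ4)
        have hnW := (norm_tt_mul_le (fW (r, R, S, V))).trans (h5.trans hδ4)
        have hB := hLv.opBeta_mem hnV htV hW.1
        have hK := hLv.opKappa_mem hnV htV hW.1
        have hE : endV (fU (r, R, S, V)) (fW (r, R, S, V)) V ∈ indep L :=
          (indep L).add_mem hU (opP_mem_indep hL.isClosed hB)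
        refine ⟨opJ_mem_indep hL.isClosed (hLi.opN_mem (h2.trans hδ4) hRm ?_),
          opJ_mem_indep hL.isClosed (hLi.opN_mem (h3.trans hδ4) hSm ?_),
          (valued L).add_mem hU.1 (intOp_mem hL.isClosed hB)⟩
        · exact (indep L).add_mem ((indep L).sub_mem ((indep L).add_mem hW
            (opP_mem_indep hL.isClosed hK)) ((indep L).smul_mem _ hE)) ((indep L).smul_mem _ hU)
        · exact (indep L).add_mem ((indep L).sub_mem (hLi.opN_mem hnW htWi
            (opP_mem_indep hL.isClosed
              (ss_mul_mem (hLv.opE_mem abs_cphi_le (ss_mul_mem htW) hK))))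
            ((indep L).smul_mem _ hE)) ((indep L).smul_mem _ hW))
  have h1 := congrArg Prod.fst hfix
  have h2 := congrArg (fun e => e.2.1) hfix
  have h3 := congrArg (fun e => e.2.2) hfix
  exact ⟨r, hr0, hg1, R, S, fU (r, R, S, V), fW (r, R, S, V), V,
    ⟨rfl, rfl, h3.symm, h1.symm, h2.symm⟩,
    ⟨hRm, hSm, hUm _ hRm, hWm _ hSm, hVm⟩, hg2, hg3, hg4, hg5, hg6⟩

end System

/-! ### Solutions of the integral equations solve the first Kashiwara–Vergne equation -/

section Algebra

variable {B : Type*} [NormedRing B] [NormedAlgebra ℝ B] [CompleteSpace B]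

theorem exp_opC (R x : B) : exp (opC R x) = exp R * exp x * exp (-R) := by
  let : NormedAlgebra ℚ B := NormedAlgebra.restrictScalars ℚ ℝ B
  rw [opC_eq]
  exact exp_units_conj ⟨exp R, exp (-R), exp_mul_exp_neg R, exp_neg_mul_exp R⟩ x

omit [CompleteSpace B] in
theorem smul_opC (c : ℝ) (R x : B) : c • opC R x = opC R (c • x) :=
  (map_smul (ent _ (ad R)) c x).symm

theorem opC_mul_exp (u f : B) : opC u f * exp u = exp u * f := by
  rw [opC_eq, mul_assoc, exp_neg_mul_exp, mul_one]

theorem opC_self_smul (t : ℝ) (u : B) : opC (t • u) u = u := by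
  have h : Commute (exp (t • u)) u := Commute.exp_left ((Commute.refl u).smul_left t)
  rw [opC_eq, h.eq, mul_assoc, exp_mul_exp_neg, mul_one]

theorem opC_opC {u w v : B} (h : exp u * exp w = exp v) (f : B) : opC u (opC w f) = opC v f := by
  have h2 : exp (-w) * exp (-u) = exp (-v) := by
    have h3 : exp v * (exp (-w) * exp (-u)) = 1 := by
      rw [← h, mul_assoc, ← mul_assoc (exp w), exp_mul_exp_neg, one_mul, exp_mul_exp_neg]
    rw [← one_mul (exp (-w) * exp (-u)), ← exp_neg_mul_exp v, mul_assoc, h3, mul_one]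
  rw [opC_eq, opC_eq, opC_eq, ← h, ← h2]
  simp only [mul_assoc]

theorem opC_eq_add (u f : B) : opC u f = f + ad u (opE cphi u f) := by
  rw [opC, opE_eq_add abs_one_le, one_smul]
  rfl

theorem opE_phi_self_smul (t : ℝ) (u : B) : opE cphi (t • u) u = u := by
  have h : (ad (t • u)) (opE (shift cphi) (t • u) u) = 0 := by
    have h1 : Commute (ent (shift cphi) (ad (t • u) : B →L[ℝ] B)) (ad (t • u)) :=
      Commute.ent_left (abs_shift_le abs_cphi_le) (Commute.refl _)
    have h2 := DFunLike.congr_fun h1.eq u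
    simp only [mul_apply_eq_comp] at h2
    refine h2.symm.trans ?_
    have : ad (t • u) u = 0 := by simp [ad_apply]
    rw [this, map_zero]
  rw [opE_eq_add abs_cphi_le, h]
  simp [cphi]

/-- Derivative of a conjugate of a one-parameter group by a moving exponential. -/
theorem hasDerivAt_conj {R : ℝ → B} {R' a x : B} {t : ℝ} (hR : HasDerivAt R R' t)
    (ha : opE cphi (R t) R' = a) :
    HasDerivAt (fun t => exp (R t) * exp (t • x) * exp (-R t))
      ((a + opC (R t) x - opC (t • opC (R t) x) a) * (exp (R t) * exp (t • x) * exp (-R t))) t := by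
  have h1 := hasDerivAt_exp_comp hR
  have h2 := hasDerivAt_exp_neg_comp hR
  have h3 := hasDerivAt_exp_smul_const' (𝕂 := ℝ) x t
  rw [show ent cphi (ad (R t)) R' = a from ha] at h1 h2
  refine ((h1.mul h3).mul h2).congr_deriv ?_
  have h4 : exp (t • opC (R t) x) = exp (R t) * exp (t • x) * exp (-R t) := by
    rw [smul_opC, exp_opC]
  rw [sub_mul, ← h4, opC_mul_exp, h4, opC_eq (R t)]
  have h5 : exp (-R t) * (exp (R t) * exp (t • x) * exp (-R t)) = exp (t • x) * exp (-R t) := by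
    rw [← mul_assoc, ← mul_assoc, exp_neg_mul_exp, one_mul]
  have h6 : exp (R t) * x * exp (-R t) * (exp (R t) * exp (t • x) * exp (-R t)) =
      exp (R t) * x * (exp (t • x) * exp (-R t)) := by
    rw [mul_assoc (exp (R t) * x), h5]
  rw [add_mul a, h6]
  simp only [Pi.mul_apply]
  noncomm_ring

end Algebra

section Verify

variable {B : Type*} [NormedRing B] [NormedAlgebra ℝ B] [CompleteSpace B]

/-- The integral of a curve has the expected derivative. -/
theorem hasDerivAt_integral_projI {f : unitInterval → B} (hf : Continuous f) (t : ℝ) :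
    HasDerivAt (fun t => ∫ τ in (0 : ℝ)..t, f (projI τ)) (f (projI t)) t :=
  (Continuous.integral_hasStrictDerivAt (f := fun τ => f (projI τ)) (by fun_prop) 0 t).hasDerivAt

theorem opBeta_apply {F : C(Sq, B)} (hF : ‖F‖ ≤ 1 / 4) (f : C(Sq, B)) (p : Sq) :
    opBeta F f p = opBeta (F p) (f p) := by
  rw [opBeta, opC, opE_apply abs_one_le, opN_apply hF]
  rfl

theorem opC_apply (F f : C(Sq, B)) (p : Sq) : opC F f p = opC (F p) (f p) :=
  opE_apply abs_one_le F f p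

variable {x y : B} {R S U W V : C(Sq, B)} {L : Submodule ℝ B}

theorem IsFlow.exp_smul_V (h : IsFlow (ContinuousMap.const Sq x) (ContinuousMap.const Sq y)
    R S U W V) (hU : U ∈ indep L) (hW : W ∈ indep L) (hV : ‖V‖ ≤ 1 / 16)
    (t s : unitInterval) :
    exp ((t : ℝ) • V (t, s)) = exp ((t : ℝ) • U (t, 1)) * exp ((s : ℝ) • ((t : ℝ) • W (t, 1))) := by
  set F := opBeta (tt * V) W with hF
  have hn : ‖tt * V‖ ≤ 1 / 4 := (norm_tt_mul_le V).trans (hV.trans (by norm_num))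
  set v : ℝ → B := fun σ => (t : ℝ) • (U (t, 1) + ∫ σ' in (0 : ℝ)..σ, F (t, projI σ')) with hv
  have hvV : ∀ σ : unitInterval, v σ = (t : ℝ) • V (t, σ) := by
    intro σ
    rw [hv]
    conv_rhs => rw [h.V_eq]
    rw [ContinuousMap.add_apply, opK_apply, hU.2 t σ 1]
  have hvd : ∀ σ : ℝ, HasDerivAt v ((t : ℝ) • F (t, projI σ)) σ := fun σ =>
    ((hasDerivAt_integral_projI (f := fun σ => F (t, σ)) (by fun_prop) σ).const_add
      (U (t, 1))).const_smul (t : ℝ)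
  set w := (t : ℝ) • W (t, 1) with hw
  have hd : ∀ σ ∈ Set.Icc (0 : ℝ) 1,
      HasDerivAt (fun σ => exp (v σ) * exp (σ • (-w))) 0 σ := by
    intro σ hσ
    have hσp : projI σ = ⟨σ, hσ⟩ := Set.projIcc_of_mem zero_le_one hσ
    have h1 := hasDerivAt_exp_comp (hvd σ)
    have h2 := hasDerivAt_exp_smul_const' (𝕂 := ℝ) (-w) σ
    refine (h1.mul h2).congr_deriv ?_
    have h3 : v σ = (t : ℝ) • V (t, ⟨σ, hσ⟩) := hvV ⟨σ, hσ⟩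
    have h4 : ent cphi (ad (v σ)) ((t : ℝ) • F (t, projI σ)) = opC (v σ) w := by
      rw [hF, hσp, map_smul, opBeta_apply hn, tt_mul_apply, hw, ← smul_opC, h3, ← hW.2 t ⟨σ, hσ⟩ 1]
      congr 1
      exact phi_opBeta ((norm_smul_le _ _).trans (by
        rw [Real.norm_of_nonneg t.2.1]
        exact (mul_le_of_le_one_left (norm_nonneg _) t.2.2).trans
          ((norm_apply_le hV _).trans (by norm_num)))) _
    rw [h4, opC_mul_exp, neg_mul, mul_neg, mul_assoc, add_neg_cancel]
  have hconst := constant_of_has_deriv_right_zero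
    (f := fun σ => exp (v σ) * exp (σ • (-w))) (a := 0) (b := 1)
    (fun σ hσ => (hd σ hσ).continuousAt.continuousWithinAt)
    (fun σ hσ => (hd σ ⟨hσ.1, hσ.2.le⟩).hasDerivWithinAt) s s.2
  simp only [hvV s, zero_smul, exp_zero, mul_one] at hconst
  have hv0 : v 0 = (t : ℝ) • U (t, 1) := by simp [hv]
  rw [hv0] at hconst
  rw [← hconst, mul_assoc, smul_neg, exp_neg_mul_exp, mul_one]

omit [CompleteSpace B] in
theorem IsFlow.endV_apply (h : IsFlow (ContinuousMap.const Sq x) (ContinuousMap.const Sq y)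
    R S U W V) (t s : unitInterval) (hU : U ∈ indep L) : endV U W V (t, s) = V (t, 1) := by
  conv_rhs => rw [h.V_eq]
  rw [endV, ContinuousMap.add_apply, ContinuousMap.add_apply, opP_apply, opK_apply, hU.2 t s 1]
  rfl

theorem IsFlow.V_one (h : IsFlow (ContinuousMap.const Sq x) (ContinuousMap.const Sq y)
    R S U W V) (hU : U ∈ indep L) (hW : W ∈ indep L) (hWn : ‖W‖ ≤ 1 / 16) (hV : ‖V‖ ≤ 1 / 16)
    (t : unitInterval) :
    V (t, 1) = U (t, 1) + (coefA U W V (t, 1) - opC ((t : ℝ) • U (t, 1)) (coefA U W V (t, 1)))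
      + opC ((t : ℝ) • U (t, 1)) (W (t, 1) + (coefB U W V (t, 1)
        - opC ((t : ℝ) • W (t, 1)) (coefB U W V (t, 1)))) := by
  have hnV : ‖tt * V‖ ≤ 1 / 4 := (norm_tt_mul_le V).trans (hV.trans (by norm_num))
  have hnW : ‖tt * W‖ ≤ 1 / 4 := (norm_tt_mul_le W).trans (hWn.trans (by norm_num))
  set C := opKappa (tt * V) W with hC
  set D := ss * opE cphi (ss * (tt * W)) C with hD
  set u := (t : ℝ) • U (t, 1) with hu
  set w := (t : ℝ) • W (t, 1) with hw
  set c := opP C (t, 1) with hc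
  set d := opP D (t, 1) with hd
  set b₀ := opN w d with hb₀
  have hwn : ‖w‖ ≤ 1 / 4 := by
    rw [hw, show (t : ℝ) • W (t, 1) = (tt * W : C(Sq, B)) (t, 1) from (tt_mul_apply W (t, 1)).symm]
    exact norm_apply_le hnW _
  have hA : coefA U W V (t, 1) = W (t, 1) + c - (1 / 4 : ℝ) • V (t, 1) +
      (1 / 4 : ℝ) • U (t, 1) := by
    rw [← h.endV_apply t 1 hU]; rfl
  have hB : coefB U W V (t, 1) = b₀ - (1 / 4 : ℝ) • V (t, 1) + (1 / 2 : ℝ) • W (t, 1) := by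
    have : opN (tt * W) (opP D) (t, 1) = b₀ := by rw [opN_apply hnW, tt_mul_apply]
    rw [← h.endV_apply t 1 hU, ← this]; rfl
  have hb : ad w d = opC w b₀ - b₀ := by
    rw [opC_eq_add, hb₀, opE_phi_opN hwn, add_sub_cancel_left]
  have hE : V (t, 1) = U (t, 1) + W (t, 1) + (c - opC u (c + ad w d)) := by
    have h1 : opP (opBeta (tt * V) W) (t, 1) = W (t, 1) + (c - opC u (c + ad w d)) := by
      have hint : ∀ σ : ℝ, opBeta (tt * V) W (t, projI σ) = W (t, 1) +
          (C (t, projI σ) - opC u (C (t, projI σ) + ad w (D (t, projI σ)))) := by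
        intro σ
        set p : Sq := (t, projI σ) with hp
        have h2 := DFunLike.congr_fun (opBeta_sub_self hnV W) p
        rw [ContinuousMap.sub_apply, ContinuousMap.sub_apply, sub_eq_iff_eq_add] at h2
        rw [h2, ← hC, opC_apply, tt_mul_apply, hW.2 t (projI σ) 1, add_comm]
        congr 2
        have h3 := h.exp_smul_V hU hW hV t (projI σ)
        rw [← opC_opC h3.symm, opC_eq_add _ (C p)]
        congr 2
        rw [hD, ss_mul_apply, opE_apply abs_cphi_le, ss_mul_apply, tt_mul_apply,
          hW.2 t (projI σ) 1, ← hw]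
        exact (DFunLike.congr_fun (map_smul ad (p.2 : ℝ) w) _).trans (map_smul (ad w) _ _).symm
      rw [opP_apply]
      simp only [hint]
      have i1 : IntervalIntegrable (fun σ => C (t, projI σ)) MeasureTheory.volume 0 1 :=
        Continuous.intervalIntegrable (by fun_prop) _ _
      have i2 : IntervalIntegrable (fun σ => D (t, projI σ)) MeasureTheory.volume 0 1 :=
        Continuous.intervalIntegrable (by fun_prop) _ _
      have i3 : IntervalIntegrable (fun σ => C (t, projI σ) + ad w (D (t, projI σ)))
          MeasureTheory.volume 0 1 :=
        Continuous.intervalIntegrable (by fun_prop) _ _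
      have i4 : IntervalIntegrable (fun σ => opC u (C (t, projI σ) + ad w (D (t, projI σ))))
          MeasureTheory.volume 0 1 :=
        Continuous.intervalIntegrable ((ent _ (ad u)).continuous.comp (by fun_prop)) _ _
      rw [intervalIntegral.integral_add (by simp) (i1.sub i4), intervalIntegral.integral_sub i1 i4]
      have h4 := (ent (fun _ => 1) (ad u : B →L[ℝ] B)).intervalIntegral_comp_comm i3
      have h5 := (ad w : B →L[ℝ] B).intervalIntegral_comp_comm i2
      rw [intervalIntegral.integral_add i1 (Continuous.intervalIntegrable (by fun_prop) _ _),
        h5] at h4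
      simp only [intervalIntegral.integral_const, sub_zero, one_smul]
      congr 2
    rw [← h.endV_apply t 1 hU, endV, ContinuousMap.add_apply, h1, add_assoc]
  have hEE : opC u (opC w (V (t, 1))) = V (t, 1) := by
    have h3 := h.exp_smul_V hU hW hV t 1
    rw [Set.Icc.coe_one, one_smul] at h3
    rw [opC_opC h3.symm, opC_self_smul]
  have hUU : opC u (U (t, 1)) = U (t, 1) := opC_self_smul _ _
  have hWW : opC w (W (t, 1)) = W (t, 1) := opC_self_smul _ _
  have hadd : ∀ a b c : B, opC a (b + c) = opC a b + opC a c := fun a b c => map_add _ _ _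
  have hsub : ∀ a b c : B, opC a (b - c) = opC a b - opC a c := fun a b c => map_sub _ _ _
  have hsm : ∀ (a : B) (r : ℝ) (c : B), opC a (r • c) = r • opC a c := fun a r c => map_smul _ _ _
  rw [hA, hB]
  simp only [hadd, hsub, hsm, hEE, hUU, hWW]
  rw [hb, hadd, hsub] at hE
  rw [← sub_eq_zero] at hE ⊢
  rw [← hE]
  module

theorem opC_zero_left (f : B) : opC 0 f = f := by
  rw [opC_eq, neg_zero, exp_zero, one_mul, mul_one]

theorem IsFlow.hasDerivAt_prod (h : IsFlow (ContinuousMap.const Sq x) (ContinuousMap.const Sq y)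
    R S U W V) (hU : U ∈ indep L) (hW : W ∈ indep L) (hR : ‖R‖ ≤ 1 / 16) (hS : ‖S‖ ≤ 1 / 16)
    (hWn : ‖W‖ ≤ 1 / 16) (hV : ‖V‖ ≤ 1 / 16) :
    ∃ Y : ℝ → B, ∀ t : unitInterval, Y t = exp ((t : ℝ) • V (t, 1)) ∧
      HasDerivAt Y (V (t, 1) * Y t) t := by
  set Rr : ℝ → B := fun t => ∫ τ in (0 : ℝ)..t, opN R (coefA U W V) (projI τ, 1) with hRr
  set Sr : ℝ → B := fun t => ∫ τ in (0 : ℝ)..t, opN S (coefB U W V) (projI τ, 1) with hSr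
  have hRv : ∀ t : unitInterval, Rr t = R (t, 1) := fun t => by
    conv_rhs => rw [h.R_eq, opJ_apply]
  have hSv : ∀ t : unitInterval, Sr t = S (t, 1) := fun t => by
    conv_rhs => rw [h.S_eq, opJ_apply]
  have hR4 : ‖R‖ ≤ 1 / 4 := hR.trans (by norm_num)
  have hS4 : ‖S‖ ≤ 1 / 4 := hS.trans (by norm_num)
  have hUR : ∀ t : unitInterval, U (t, 1) = opC (Rr t) x := fun t => by
    rw [h.U_eq, opC_apply, hRv]; rfl
  have hWS : ∀ t : unitInterval, W (t, 1) = opC (Sr t) y := fun t => by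
    rw [h.W_eq, opC_apply, hSv]; rfl
  refine ⟨fun t => (exp (Rr t) * exp (t • x) * exp (-Rr t)) *
    (exp (Sr t) * exp (t • y) * exp (-Sr t)), fun t => ?_⟩
  have hP : exp (Rr t) * exp ((t : ℝ) • x) * exp (-Rr t) = exp ((t : ℝ) • U (t, 1)) := by
    rw [hUR, smul_opC, exp_opC]
  have hQ : exp (Sr t) * exp ((t : ℝ) • y) * exp (-Sr t) = exp ((t : ℝ) • W (t, 1)) := by
    rw [hWS, smul_opC, exp_opC]
  have hd1 := hasDerivAt_conj (x := x) (a := coefA U W V (t, 1))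
    (hasDerivAt_integral_projI (f := fun τ => opN R (coefA U W V) (τ, 1)) (by fun_prop) (t : ℝ))
    (by
      have := hRv t
      simp only [hRr] at this
      rw [projI_coe, this, opE_phi_opN_apply hR4])
  have hd2 := hasDerivAt_conj (x := y) (a := coefB U W V (t, 1))
    (hasDerivAt_integral_projI (f := fun τ => opN S (coefB U W V) (τ, 1)) (by fun_prop) (t : ℝ))
    (by
      have := hSv t
      simp only [hSr] at this
      rw [projI_coe, this, opE_phi_opN_apply hS4])
  refine ⟨?_, (hd1.mul hd2).congr_deriv ?_⟩
  · have := h.exp_smul_V hU hW hV t 1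
    rw [Set.Icc.coe_one, one_smul] at this
    rw [this, ← hP, ← hQ]
  · change ((_ + opC (Rr t) x - opC ((t : ℝ) • opC (Rr t) x) _) *
      (exp (Rr t) * exp ((t : ℝ) • x) * exp (-Rr t))) *
      (exp (Sr t) * exp ((t : ℝ) • y) * exp (-Sr t)) +
      (exp (Rr t) * exp ((t : ℝ) • x) * exp (-Rr t)) *
      ((_ + opC (Sr t) y - opC ((t : ℝ) • opC (Sr t) y) _) *
      (exp (Sr t) * exp ((t : ℝ) • y) * exp (-Sr t))) = V (t, 1) *
      ((exp (Rr t) * exp ((t : ℝ) • x) * exp (-Rr t)) *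
      (exp (Sr t) * exp ((t : ℝ) • y) * exp (-Sr t)))
    rw [hP, hQ, ← hUR, ← hWS, ← mul_assoc (exp _) _ (exp ((t : ℝ) • W (t, 1))), ← opC_mul_exp,
      mul_assoc (opC _ _), mul_assoc _ (exp _) (exp _), ← add_mul]
    congr 1
    conv_rhs => rw [h.V_one hU hW hWn hV t]
    congr 1
    · abel
    · congr 1
      abel

theorem IsFlow.exp_mul_exp (h : IsFlow (ContinuousMap.const Sq x) (ContinuousMap.const Sq y)
    R S U W V) (hU : U ∈ indep L) (hW : W ∈ indep L) (hR : ‖R‖ ≤ 1 / 16) (hS : ‖S‖ ≤ 1 / 16)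
    (hWn : ‖W‖ ≤ 1 / 16) (hV : ‖V‖ ≤ 1 / 16) :
    exp (U (1, 1)) * exp (W (1, 1)) = exp (x + y) := by
  obtain ⟨Y, hY⟩ := h.hasDerivAt_prod hU hW hR hS hWn hV
  set E : ℝ → B := fun t => V (projI t, 1) with hE
  have hEc : Continuous E := by fun_prop
  have hEt : ∀ t : unitInterval, E t = V (t, 1) := fun t => by rw [hE]; simp only [projI_coe]
  have hnorm : ∀ t : unitInterval, ‖(t : ℝ) • E t‖ ≤ 1 / 16 := fun t => by
    rw [hEt, norm_smul, Real.norm_of_nonneg t.2.1]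
    exact (mul_le_of_le_one_left (norm_nonneg _) t.2.2).trans (norm_apply_le hV _)
  have hYE : ∀ t : unitInterval, Y t = exp ((t : ℝ) • E t) := fun t => by rw [(hY t).1, hEt]
  have hlog2 : (1 / 16 : ℝ) < Real.log 2 := by linarith [Real.log_two_gt_d9]
  have hM : ∀ t : unitInterval, rlog (Y t) = (t : ℝ) • E t := fun t => by
    rw [hYE, rlog_exp ((hnorm t).trans_lt hlog2)]
  have hderiv : ∀ t ∈ Set.Ioo (0 : ℝ) 1, HasDerivAt E 0 t := by
    intro t ht
    have hnear : ∀ᶠ τ in 𝓝 t, τ ∈ Set.Ioo (0 : ℝ) 1 := isOpen_Ioo.mem_nhds ht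
    let t' : unitInterval := ⟨t, ht.1.le, ht.2.le⟩
    have hYd : HasDerivAt Y (E t * Y t) t := by
      have := (hY t').2
      rwa [← hEt] at this
    have hY1 : ‖Y t - 1‖ < 1 := by
      rw [hYE t']
      refine (norm_exp_sub_one_le _).trans_lt ?_
      have : Real.exp ‖(t' : ℝ) • E t'‖ < 2 := by
        rw [← Real.lt_log_iff_exp_lt two_pos]
        exact (hnorm t').trans_lt hlog2
      linarith
    have hMd : HasDerivAt (fun τ => rlog (Y τ)) (deriv (fun τ => rlog (Y τ)) t) t :=
      ((differentiableAt_rlog hY1).comp t hYd.differentiableAt).hasDerivAt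
    set M' := deriv (fun τ => rlog (Y τ)) t
    have h1 := hasDerivAt_exp_comp hMd
    have h2 : HasDerivAt (fun τ => exp (rlog (Y τ))) (E t * Y t) t := by
      refine hYd.congr_of_eventuallyEq ?_
      filter_upwards [hnear] with τ hτ
      rw [hM ⟨τ, hτ.1.le, hτ.2.le⟩, hYE ⟨τ, hτ.1.le, hτ.2.le⟩]
    have h3 := h1.unique h2
    have hMt : rlog (Y t) = t • E t := hM t'
    have hYt : Y t = exp (t • E t) := hYE t'
    rw [hMt, hYt] at h3
    have h4 : opE cphi (t • E t) M' = E t := by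
      have := congrArg (· * exp (-(t • E t))) h3
      simp only [mul_assoc, exp_mul_exp_neg, mul_one] at this
      exact this
    have hn4 : ‖t • E t‖ ≤ 1 / 4 := (hnorm t').trans (by norm_num)
    have h5 : M' = E t := by
      rw [← opN_opE_phi hn4 M', h4]
      conv_rhs => rw [← opN_opE_phi hn4 (E t), opE_phi_self_smul]
    have h6 : HasDerivAt (fun τ => τ⁻¹ • rlog (Y τ)) 0 t := by
      refine ((hasDerivAt_inv ht.1.ne').smul hMd).congr_deriv ?_
      rw [h5, hMt, smul_smul, ← add_smul]
      have : t⁻¹ + -(t ^ 2)⁻¹ * t = 0 := by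
        field_simp [ht.1.ne']
        ring
      rw [this, zero_smul]
    refine h6.congr_of_eventuallyEq ?_
    filter_upwards [hnear] with τ hτ
    rw [hM ⟨τ, hτ.1.le, hτ.2.le⟩, smul_smul, inv_mul_cancel₀ hτ.1.ne', one_smul]
  have hconst : ∀ a ∈ Set.Ioo (0 : ℝ) 1, E a = E 1 := by
    intro a ha
    exact (constant_of_has_deriv_right_zero hEc.continuousOn (fun σ hσ =>
      (hderiv σ ⟨ha.1.trans_le hσ.1, hσ.2⟩).hasDerivWithinAt) 1 ⟨ha.2.le, le_rfl⟩).symm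
  have h01 : E 0 = E 1 := by
    refine tendsto_nhds_unique (hEc.continuousWithinAt (s := Set.Ioi 0) (x := 0)) ?_
    refine tendsto_const_nhds.congr' ?_
    filter_upwards [Ioo_mem_nhdsGT zero_lt_one] with a ha
    exact (hconst a ha).symm
  have hV1 : V (1, 1) = V (0, 1) := by
    have h0 := hEt 0
    have h1 := hEt 1
    rw [Set.Icc.coe_zero] at h0
    rw [Set.Icc.coe_one] at h1
    rw [← h0, ← h1, h01]
  have hR0 : R (0, 1) = 0 := by rw [h.R_eq, opJ_apply]; simp
  have hS0 : S (0, 1) = 0 := by rw [h.S_eq, opJ_apply]; simp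
  have hU0 : U (0, 1) = x := by rw [h.U_eq, opC_apply, hR0, opC_zero_left]; rfl
  have hW0 : W (0, 1) = y := by rw [h.W_eq, opC_apply, hS0, opC_zero_left]; rfl
  have hV0 : V (0, 1) = x + y := by
    rw [h.V_one hU hW hWn hV 0, hU0, hW0, Set.Icc.coe_zero, zero_smul, zero_smul]
    simp only [opC_zero_left, sub_self, add_zero]
  have := h.exp_smul_V hU hW hV 1 1
  simp only [Set.Icc.coe_one, one_smul] at this
  rw [← this, hV1, hV0]

end Verify

/-! ### The free closed Lie algebra -/

namespace FreeBanach

/-- The closed real Lie algebra generated by the two generators. -/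
def lie : Submodule ℝ FreeBanach := sInf {S | IsClosedLie S ∧ gx ∈ S ∧ gy ∈ S}

theorem lie_le {S : Submodule ℝ FreeBanach} (hS : IsClosedLie S) (hx : gx ∈ S) (hy : gy ∈ S) :
    lie ≤ S := sInf_le ⟨hS, hx, hy⟩

theorem gx_mem_lie : gx ∈ lie := Submodule.mem_sInf.2 fun _ hS => hS.2.1

theorem gy_mem_lie : gy ∈ lie := Submodule.mem_sInf.2 fun _ hS => hS.2.2

theorem isClosedLie_lie : IsClosedLie lie where
  isClosed := by
    rw [lie, Submodule.coe_sInf]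
    exact isClosed_biInter fun S hS => hS.1.isClosed
  ad_mem a ha b hb := Submodule.mem_sInf.2 fun S hS =>
    hS.1.ad_mem a (Submodule.mem_sInf.1 ha S hS) b (Submodule.mem_sInf.1 hb S hS)

theorem map_ad {D : Type*} [NormedRing D] [NormedAlgebra ℝ D] (θ : FreeBanach →A[ℝ] D)
    (a b : FreeBanach) : θ (ad a b) = ad (θ a) (θ b) := by
  simp only [ad_apply, map_sub, map_mul]

/-- A closed Lie algebra that contains the values of the generators contains all values of Lie
elements. -/
theorem map_mem_of_mem_lie {D : Type*} [NormedRing D] [NormedAlgebra ℝ D]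
    (θ : FreeBanach →A[ℝ] D) {S : Submodule ℝ D} (hS : IsClosedLie S) (hx : θ gx ∈ S)
    (hy : θ gy ∈ S) {ρ : FreeBanach} (hρ : ρ ∈ lie) : θ ρ ∈ S := by
  refine lie_le (S := S.comap θ.toLinearMap) ⟨hS.isClosed.preimage θ.cont, fun a ha b hb => ?_⟩
    hx hy hρ
  have := hS.ad_mem _ ha _ hb
  change θ (ad a b) ∈ S
  rw [map_ad]
  exact this

theorem exists_half : ∃ θ : FreeBanach →A[ℝ] FreeBanach,
    θ gx = (1 / 2 : ℝ) • gx ∧ θ gy = (1 / 2 : ℝ) • gy ∧ ∀ a, ‖θ a‖ ≤ ‖a‖ := by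
  have h : ∀ w, ‖(1 / 2 : ℝ) • word w‖ ≤ 1 := fun w => by
    rw [norm_smul, norm_word]; norm_num
  exact exists_eval norm_one.le (h _) (h _)

theorem exists_ad_half : ∃ θ : FreeBanach →A[ℝ] (FreeBanach →L[ℝ] FreeBanach),
    θ gx = (1 / 2 : ℝ) • ad gx ∧ θ gy = (1 / 2 : ℝ) • ad gy := by
  have h : ∀ w, ‖(1 / 2 : ℝ) • ad (word w)‖ ≤ 1 := fun w => by
    rw [norm_smul]
    have := norm_ad_le (word w)
    rw [norm_word] at this
    norm_num
    linarith
  obtain ⟨θ, hx, hy, -⟩ := exists_eval (D := FreeBanach →L[ℝ] FreeBanach)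
    ContinuousLinearMap.norm_id_le (h _) (h _)
  exact ⟨θ, hx, hy⟩

/-- The substitution that halves the generators. -/
def half : FreeBanach →A[ℝ] FreeBanach := exists_half.choose

theorem half_gx : half gx = (1 / 2 : ℝ) • gx := exists_half.choose_spec.1

theorem half_gy : half gy = (1 / 2 : ℝ) • gy := exists_half.choose_spec.2.1

theorem norm_half_le (a : FreeBanach) : ‖half a‖ ≤ ‖a‖ := exists_half.choose_spec.2.2 a

/-- The substitution of the halved adjoint operators of the generators. -/
def adHalf : FreeBanach →A[ℝ] (FreeBanach →L[ℝ] FreeBanach) := exists_ad_half.choose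

theorem adHalf_gx : adHalf gx = (1 / 2 : ℝ) • ad gx := exists_ad_half.choose_spec.1

theorem adHalf_gy : adHalf gy = (1 / 2 : ℝ) • ad gy := exists_ad_half.choose_spec.2

theorem half_mem_lie {ρ : FreeBanach} (hρ : ρ ∈ lie) : half ρ ∈ lie := by
  refine map_mem_of_mem_lie half isClosedLie_lie ?_ ?_ hρ
  · rw [half_gx]; exact lie.smul_mem _ gx_mem_lie
  · rw [half_gy]; exact lie.smul_mem _ gy_mem_lie

theorem adHalf_mem_lie (τ : FreeBanach) {f : FreeBanach} (hf : f ∈ lie) : adHalf τ f ∈ lie := by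
  have hp : ∀ g ∈ lie, (1 / 2 : ℝ) • ad g ∈ preserving lie := fun g hg f hf =>
    lie.smul_mem _ (isClosedLie_lie.ad_mem g hg f hf)
  refine eq_top_of_word_mem
    ((Subalgebra.toSubmodule (preserving lie)).comap adHalf.toLinearMap)
    ((isClosed_preserving isClosedLie_lie.isClosed).preimage adHalf.cont) (fun w => ?_) τ f hf
  change adHalf (word w) ∈ preserving lie
  induction w using FreeMonoid.inductionOn' with
  | one => rw [word_one, map_one]; exact one_mem _
  | of_mul i w ih =>
    rw [← word_mul, map_mul]
    refine mul_mem ?_ ih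
    cases i
    · exact adHalf_gy ▸ hp _ gy_mem_lie
    · exact adHalf_gx ▸ hp _ gx_mem_lie

theorem ad_half {ρ : FreeBanach} (hρ : ρ ∈ lie) : ad (half ρ) = adHalf ρ := by
  refine lie_le (S := LinearMap.eqLocus
    (ad.toLinearMap.comp half.toLinearMap) adHalf.toLinearMap)
    ⟨isClosed_eq (ad.continuous.comp half.cont) adHalf.cont, fun a ha b hb => ?_⟩ ?_ ?_ hρ
  · change ad (half a) = adHalf a at ha
    change ad (half b) = adHalf b at hb
    change ad (half (ad a b)) = adHalf (ad a b)
    rw [map_ad, map_ad, ← ha, ← hb]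
    ext f
    simp only [ad_apply, sub_apply, mul_apply_eq_comp]
    noncomm_ring
  · change ad (half gx) = adHalf gx
    rw [half_gx, adHalf_gx, map_smul]
  · change ad (half gy) = adHalf gy
    rw [half_gy, adHalf_gy, map_smul]

theorem eq_mul_leftDiv_add {ρ : FreeBanach} (hρ : ρ ∈ lie) :
    ρ = gx * leftDiv true ρ + gy * leftDiv false ρ := by
  obtain ⟨θ, hx, hy, -⟩ := exists_eval (D := ℝ) (p := 0) (q := 0) norm_one.le (by simp) (by simp)
  have h0 : θ ρ = 0 := by
    have hbot : IsClosedLie (⊥ : Submodule ℝ ℝ) :=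
      ⟨by simp, fun a _ b _ => by simp [ad_apply, mul_comm]⟩
    simpa using map_mem_of_mem_lie θ hbot (by simp [hx]) (by simp [hy]) hρ
  conv_lhs => rw [exists_const_add θ hx hy ρ]
  rw [h0, map_zero, zero_add]

theorem half_ad {ρ f : FreeBanach} (hρ : ρ ∈ lie) :
    half (ad ρ f) = ad gx ((1 / 2 : ℝ) • adHalf (leftDiv true ρ) (half f))
      + ad gy ((1 / 2 : ℝ) • adHalf (leftDiv false ρ) (half f)) := by
  rw [map_ad, ad_half hρ]
  conv_lhs => rw [eq_mul_leftDiv_add hρ, map_add, map_mul, map_mul, adHalf_gx, adHalf_gy]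
  simp only [add_apply, mul_apply_eq_comp, smul_apply, map_smul]

/-! ### The span of the commutators with the generators -/

/-- The functions with values of the form `[x, p] + [y, q]`, after halving the generators. -/
def brackets : Submodule ℝ C(Sq, FreeBanach) where
  carrier := {f | ∃ p ∈ valued lie, ∃ q ∈ valued lie,
    ∀ s, half (f s) = ad gx (p s) + ad gy (q s)}
  zero_mem' := ⟨0, zero_mem _, 0, zero_mem _, fun s => by simp⟩
  add_mem' := by
    rintro f g ⟨p, hp, q, hq, h⟩ ⟨p', hp', q', hq', h'⟩
    refine ⟨p + p', add_mem hp hp', q + q', add_mem hq hq', fun s => ?_⟩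
    rw [ContinuousMap.add_apply, map_add, h, h']
    simp only [ContinuousMap.add_apply, map_add]
    abel
  smul_mem' := by
    rintro c f ⟨p, hp, q, hq, h⟩
    refine ⟨c • p, Submodule.smul_mem _ c hp, c • q, Submodule.smul_mem _ c hq, fun s => ?_⟩
    rw [ContinuousMap.smul_apply, map_smul, h]
    simp only [ContinuousMap.smul_apply, map_smul, smul_add]

theorem ad_mem_brackets {F f : C(Sq, FreeBanach)} (hF : F ∈ valued lie) (hf : f ∈ valued lie) :
    ad F f ∈ brackets := by
  have hc : Continuous adHalf := adHalf.cont
  have hh : Continuous half := half.cont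
  have hd : ∀ i, Continuous fun s => (1 / 2 : ℝ) • adHalf (leftDiv i (F s)) (half (f s)) :=
    fun i => ((hc.comp ((leftDiv i).continuous.comp F.continuous)).clm_apply
      (hh.comp f.continuous)).const_smul (1 / 2 : ℝ)
  have hm : ∀ i s, (1 / 2 : ℝ) • adHalf (leftDiv i (F s)) (half (f s)) ∈ lie := fun i s =>
    lie.smul_mem _ (adHalf_mem_lie _ (half_mem_lie (hf s)))
  exact ⟨⟨_, hd true⟩, hm true, ⟨_, hd false⟩, hm false, fun s => half_ad (hF s)⟩

theorem intOp_mem_brackets {u : C(Sq, ℝ)} {hu : ∀ p, u p ∈ unitInterval} {k : C(Sq × ℝ, Sq)}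
    {f : C(Sq, FreeBanach)} (hf : f ∈ brackets) : intOp u hu k f ∈ brackets := by
  obtain ⟨p, hp, q, hq, h⟩ := hf
  refine ⟨intOp u hu k p, intOp_mem isClosedLie_lie.isClosed hp, intOp u hu k q,
    intOp_mem isClosedLie_lie.isClosed hq, fun s => ?_⟩
  have hi : ∀ g : C(Sq, FreeBanach),
      IntervalIntegrable (fun σ => g (k (s, σ))) MeasureTheory.volume 0 (u s) := fun g =>
    Continuous.intervalIntegrable (by fun_prop) _ _
  have h1 := half.toContinuousLinearMap.intervalIntegral_comp_comm (hi f)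
  have h2 := (ad gx).intervalIntegral_comp_comm (hi p)
  have h3 := (ad gy).intervalIntegral_comp_comm (hi q)
  rw [intOp_apply, intOp_apply, intOp_apply]
  refine h1.symm.trans ?_
  rw [← h2, ← h3, ← intervalIntegral.integral_add
    (Continuous.intervalIntegrable (by fun_prop) _ _)
    (Continuous.intervalIntegrable (by fun_prop) _ _)]
  exact intervalIntegral.integral_congr fun σ _ => h _

theorem ss_mul_mem_brackets {f : C(Sq, FreeBanach)} (hf : f ∈ brackets) : ss * f ∈ brackets := by
  obtain ⟨p, hp, q, hq, h⟩ := hf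
  refine ⟨ss * p, ss_mul_mem hp, ss * q, ss_mul_mem hq, fun s => ?_⟩
  simp only [ss_mul_apply, map_smul, h, smul_add]

theorem opE_sub_mem_brackets {c : ℕ → ℝ} (hc : ∀ n, |c n| ≤ 1) {F f : C(Sq, FreeBanach)}
    (hF : F ∈ valued lie) (hf : f ∈ valued lie) : opE c F f - c 0 • f ∈ brackets := by
  rw [opE_eq_add hc, add_sub_cancel_left]
  exact ad_mem_brackets hF (isClosedLie_lie.valued.opE_mem (abs_shift_le hc) hF hf)

theorem opN_sub_mem_brackets {F f : C(Sq, FreeBanach)} (hn : ‖F‖ ≤ 1 / 4)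
    (hF : F ∈ valued lie) (hf : f ∈ valued lie) : opN F f - f ∈ brackets := by
  rw [opN_eq_add hn, sub_sub_cancel_left]
  exact neg_mem (ad_mem_brackets hF (isClosedLie_lie.valued.opE_mem (abs_shift_le abs_cphi_le) hF
    (isClosedLie_lie.valued.opN_mem hn hF hf)))

theorem opC_sub_mem_brackets {F f : C(Sq, FreeBanach)} (hF : F ∈ valued lie)
    (hf : f ∈ valued lie) : opC F f - f ∈ brackets := by
  have h := opE_sub_mem_brackets abs_one_le hF hf
  rwa [one_smul] at h

theorem opBeta_sub_mem_brackets {F f : C(Sq, FreeBanach)} (hn : ‖F‖ ≤ 1 / 4)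
    (hF : F ∈ valued lie) (hf : f ∈ valued lie) : opBeta F f - f ∈ brackets := by
  rw [← sub_add_sub_cancel _ (opN F f)]
  exact add_mem (opC_sub_mem_brackets hF (isClosedLie_lie.valued.opN_mem hn hF hf))
    (opN_sub_mem_brackets hn hF hf)

theorem opKappa_add_mem_brackets {F f : C(Sq, FreeBanach)} (hn : ‖F‖ ≤ 1 / 4)
    (hF : F ∈ valued lie) (hf : f ∈ valued lie) :
    opKappa F f + (1 / 2 : ℝ) • f ∈ brackets := by
  have h1 := isClosedLie_lie.valued.opN_mem hn hF hf
  have h2 := isClosedLie_lie.valued.opN_mem hn hF h1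
  have h3 := opE_sub_mem_brackets abs_ceta_le hF h2
  have h4 := Submodule.smul_mem _ (1 / 2 : ℝ)
    (add_mem (opN_sub_mem_brackets hn hF h1) (opN_sub_mem_brackets hn hF hf))
  have h5 := neg_mem (add_mem h3 h4)
  convert h5 using 1
  simp only [opKappa, ceta, Nat.cast_zero, zero_add]
  module

section Flow

variable {x y R S U W V : C(Sq, FreeBanach)}

theorem opP_eq_self {f : C(Sq, FreeBanach)} {L : Submodule ℝ FreeBanach} (hf : f ∈ indep L) :
    opP f = f := by
  ext p
  rw [opP_apply]
  simp only [hf.2 p.1 _ p.2, intervalIntegral.integral_const, sub_zero, one_smul]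

theorem opP_ss_mul {f : C(Sq, FreeBanach)} {L : Submodule ℝ FreeBanach} (hf : f ∈ indep L) :
    opP (ss * f) = (1 / 2 : ℝ) • f := by
  ext p
  rw [opP_apply]
  have h : ∀ σ ∈ Set.uIcc (0 : ℝ) 1, (ss * f : C(Sq, FreeBanach)) (p.1, projI σ) = σ • f p := by
    intro σ hσ
    rw [Set.uIcc_of_le zero_le_one] at hσ
    have hp : projI σ = ⟨σ, hσ⟩ := Set.projIcc_of_mem zero_le_one hσ
    rw [ss_mul_apply, hp, hf.2 p.1 _ p.2]
  rw [intervalIntegral.integral_congr h, intervalIntegral.integral_smul_const, integral_id]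
  norm_num

/-- The endpoints of the two conjugating curves, up to commutators with the generators. -/
theorem _root_.BanachKV.IsFlow.sub_mem_brackets (h : IsFlow x y R S U W V)
    (hx : x ∈ indep lie) (hy : y ∈ indep lie) (hRm : R ∈ valued lie) (hSm : S ∈ valued lie)
    (hUm : U ∈ valued lie) (hWm : W ∈ valued lie)
    (hVm : V ∈ valued lie) (hR : ‖R‖ ≤ 1 / 4) (hS : ‖S‖ ≤ 1 / 4) (hW : ‖W‖ ≤ 1 / 4)
    (hV : ‖V‖ ≤ 1 / 4) :
    R - opJ ((1 / 4 : ℝ) • y) ∈ brackets ∧ S + opJ ((1 / 4 : ℝ) • x) ∈ brackets := by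
  have hL := isClosedLie_lie
  have hnV : ‖tt * V‖ ≤ 1 / 4 := (norm_tt_mul_le V).trans hV
  have hnW : ‖tt * W‖ ≤ 1 / 4 := (norm_tt_mul_le W).trans hW
  have htV := tt_mul_mem hVm
  have htW := tt_mul_mem hWm
  have hstW := ss_mul_mem htW
  have hBm := hL.valued.opBeta_mem hnV htV hWm
  have hCm := hL.valued.opKappa_mem hnV htV hWm
  have hDm := hL.valued.opE_mem abs_cphi_le hstW hCm
  have hEm : endV U W V ∈ valued lie := add_mem hUm (intOp_mem hL.isClosed hBm)
  have hPD : opP (ss * opE cphi (ss * (tt * W)) (opKappa (tt * V) W)) ∈ valued lie :=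
    intOp_mem hL.isClosed (ss_mul_mem hDm)
  have ham : coefA U W V ∈ valued lie :=
    add_mem (sub_mem (add_mem hWm (intOp_mem hL.isClosed hCm)) (Submodule.smul_mem _ _ hEm))
      (Submodule.smul_mem _ _ hUm)
  have hbm : coefB U W V ∈ valued lie :=
    add_mem (sub_mem (hL.valued.opN_mem hnW htW hPD) (Submodule.smul_mem _ _ hEm))
      (Submodule.smul_mem _ _ hWm)
  have cU : U - x ∈ brackets := by rw [h.U_eq]; exact opC_sub_mem_brackets hRm hx.1
  have cW : W - y ∈ brackets := by rw [h.W_eq]; exact opC_sub_mem_brackets hSm hy.1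
  have cE : endV U W V - (x + y) ∈ brackets := by
    have h1 : opP (opBeta (tt * V) W - W + (W - y)) ∈ brackets :=
      intOp_mem_brackets (add_mem (opBeta_sub_mem_brackets hnV htV hWm) cW)
    rw [sub_add_sub_cancel, map_sub, opP_eq_self hy] at h1
    convert add_mem cU h1 using 1
    rw [endV]
    abel
  have cC : opKappa (tt * V) W + (1 / 2 : ℝ) • y ∈ brackets := by
    convert sub_mem (opKappa_add_mem_brackets hnV htV hWm)
      (Submodule.smul_mem _ (1 / 2 : ℝ) cW) using 1
    module
  have cPC : opP (opKappa (tt * V) W) + (1 / 2 : ℝ) • y ∈ brackets := by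
    have h1 : opP (opKappa (tt * V) W + (1 / 2 : ℝ) • y) ∈ brackets := intOp_mem_brackets cC
    rwa [map_add, map_smul, opP_eq_self hy] at h1
  have ca : coefA U W V - (1 / 4 : ℝ) • y ∈ brackets := by
    convert add_mem (add_mem cW cPC)
      (Submodule.smul_mem _ (1 / 4 : ℝ) (sub_mem cU cE)) using 1
    rw [coefA]
    module
  have cD : opE cphi (ss * (tt * W)) (opKappa (tt * V) W) + (1 / 2 : ℝ) • y ∈ brackets := by
    convert add_mem (opE_sub_mem_brackets abs_cphi_le hstW hCm) cC using 1
    simp only [cphi, Nat.cast_zero, zero_add, div_one, one_smul]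
    abel
  have cPD : opP (ss * opE cphi (ss * (tt * W)) (opKappa (tt * V) W)) + (1 / 4 : ℝ) • y
      ∈ brackets := by
    have h1 : opP (ss * (opE cphi (ss * (tt * W)) (opKappa (tt * V) W) + (1 / 2 : ℝ) • y))
      ∈ brackets := intOp_mem_brackets (ss_mul_mem_brackets cD)
    rw [mul_add, map_add, opP_ss_mul (Submodule.smul_mem _ (1 / 2 : ℝ) hy), smul_smul] at h1
    norm_num at h1 ⊢
    exact h1
  have cb : coefB U W V + (1 / 4 : ℝ) • x ∈ brackets := by
    convert add_mem (add_mem (add_mem (opN_sub_mem_brackets hnW htW hPD) cPD)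
      (Submodule.smul_mem _ (-1 / 4 : ℝ) cE)) (Submodule.smul_mem _ (1 / 2 : ℝ) cW) using 1
    rw [coefB]
    module
  constructor
  · have h1 : opJ (opN R (coefA U W V) - coefA U W V + (coefA U W V - (1 / 4 : ℝ) • y))
        ∈ brackets := intOp_mem_brackets (add_mem (opN_sub_mem_brackets hR hRm ham) ca)
    rw [sub_add_sub_cancel, map_sub, ← h.R_eq] at h1
    exact h1
  · have h1 : opJ (opN S (coefB U W V) - coefB U W V + (coefB U W V + (1 / 4 : ℝ) • x))
        ∈ brackets := intOp_mem_brackets (add_mem (opN_sub_mem_brackets hS hSm hbm) cb)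
    rw [← add_assoc, sub_add_cancel, map_add, ← h.S_eq] at h1
    exact h1

end Flow

theorem map_exp {D : Type*} [NormedRing D] [NormedAlgebra ℝ D] [CompleteSpace D]
    (θ : FreeBanach →A[ℝ] D) (a : FreeBanach) : θ (exp a) = exp (θ a) := by
  let : NormedAlgebra ℚ FreeBanach := NormedAlgebra.restrictScalars ℚ ℝ FreeBanach
  let : NormedAlgebra ℚ D := NormedAlgebra.restrictScalars ℚ ℝ D
  exact NormedSpace.map_exp θ θ.cont a

theorem map_opC {D : Type*} [NormedRing D] [NormedAlgebra ℝ D] [CompleteSpace D]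
    (θ : FreeBanach →A[ℝ] D) (a b : FreeBanach) : θ (opC a b) = opC (θ a) (θ b) := by
  simp only [opC_eq, map_mul, map_exp, map_neg]

/-- The universal solution of the first Kashiwara–Vergne equation. -/
theorem exists_solution : ∃ r : ℝ, 0 < r ∧ ∃ R ∈ lie, ∃ S ∈ lie,
    ∃ R' ∈ lie, ∃ R'' ∈ lie, ∃ S' ∈ lie, ∃ S'' ∈ lie,
      ‖opC R (r • gx)‖ ≤ 1 / 16 ∧ ‖opC S (r • gy)‖ ≤ 1 / 16 ∧
      exp (opC R (r • gx)) * exp (opC S (r • gy)) = exp (r • gx + r • gy) ∧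
      R = (r / 4) • gy + ad gx R' + ad gy R'' ∧ S = -((r / 4) • gx) + ad gx S' + ad gy S'' ∧
      r ≤ 1 / 16 := by
  obtain ⟨r, hr, hrδ, R, S, U, W, V, h, ⟨hRm, hSm, hUm, hWm, hVm⟩, hR, hS, hU, hW, hV⟩ :=
    exists_flow isClosedLie_lie gx_mem_lie gy_mem_lie (δ := 1 / 16) (by norm_num) (by norm_num)
  have h4 : ∀ {F : C(Sq, FreeBanach)}, ‖F‖ ≤ 1 / 16 → ‖F‖ ≤ 1 / 4 := fun hF =>
    hF.trans (by norm_num)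
  obtain ⟨⟨p, hp, q, hq, hpq⟩, ⟨p', hp', q', hq', hpq'⟩⟩ := h.sub_mem_brackets
    (Submodule.smul_mem _ r (const_mem gx_mem_lie)) (Submodule.smul_mem _ r (const_mem gy_mem_lie))
    hRm.1 hSm.1 hUm.1 hWm.1 hVm (h4 hR) (h4 hS) (h4 hW) (h4 hV)
  have hJ : ∀ g : FreeBanach, opJ ((1 / 4 : ℝ) • r • ContinuousMap.const Sq g) (1, 1) =
      (r / 4) • g := fun g => by
    rw [opJ_apply]
    simp only [ContinuousMap.smul_apply, ContinuousMap.const_apply,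
      intervalIntegral.integral_const, Set.Icc.coe_one, sub_zero, smul_smul]
    congr 1
    ring
  have hx : half (r • gx) = (r / 2) • gx := by
    rw [map_smul, half_gx, smul_smul]; congr 1; ring
  have hy : half (r • gy) = (r / 2) • gy := by
    rw [map_smul, half_gy, smul_smul]; congr 1; ring
  have hconst : ∀ g : FreeBanach, r • ContinuousMap.const Sq g = ContinuousMap.const Sq (r • g) :=
    fun g => rfl
  have hU1 : half (U (1, 1)) = opC (half (R (1, 1))) ((r / 2) • gx) := by
    rw [h.U_eq, opC_apply, map_opC, ← hx]; rfl
  have hW1 : half (W (1, 1)) = opC (half (S (1, 1))) ((r / 2) • gy) := by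
    rw [h.W_eq, opC_apply, map_opC, ← hy]; rfl
  refine ⟨r / 2, by positivity, half (R (1, 1)), half_mem_lie (hRm.1 _), half (S (1, 1)),
    half_mem_lie (hSm.1 _), p (1, 1), hp _, q (1, 1), hq _, p' (1, 1), hp' _, q' (1, 1), hq' _,
    ?_, ?_, ?_, ?_, ?_, by linarith⟩
  · rw [← hU1]; exact (norm_half_le _).trans (norm_apply_le hU _)
  · rw [← hW1]; exact (norm_half_le _).trans (norm_apply_le hW _)
  · rw [← hU1, ← hW1, ← hx, ← hy, ← map_exp, ← map_exp, ← map_mul, ← map_add, ← map_exp]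
    rw [hconst, hconst] at h
    rw [h.exp_mul_exp hUm hWm hR hS hW hV]
  · have h1 := hpq (1, 1)
    rw [ContinuousMap.sub_apply, hJ, map_sub, map_smul, half_gy, smul_smul] at h1
    rw [add_assoc, ← h1, show r / 4 * (1 / 2) = r / 2 / 4 by ring]
    abel
  · have h1 := hpq' (1, 1)
    rw [ContinuousMap.add_apply, hJ, map_add, map_smul, half_gx, smul_smul] at h1
    rw [add_assoc, ← h1, show r / 4 * (1 / 2) = r / 2 / 4 by ring]
    abel

end FreeBanach

/-! ### Values of the universal solution -/

section Unitization

variable {A : Type*} [NonUnitalNormedRing A] [NormedSpace ℂ A]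

theorem norm_incl (a : A) : ‖incl a‖ = ‖a‖ := WithLp.unitization_norm_inr a

omit [NormedSpace ℂ A] in
theorem incl_add (a b : A) : incl (a + b) = incl a + incl b := by
  apply WithLp.ofLp_injective
  apply Unitization.ext <;> simp [incl]

omit [NormedSpace ℂ A] in
theorem incl_neg (a : A) : incl (-a) = -incl a := by
  apply WithLp.ofLp_injective
  apply Unitization.ext <;> simp [incl]

omit [NormedSpace ℂ A] in
theorem incl_zero : incl (0 : A) = 0 := by
  apply WithLp.ofLp_injective
  apply Unitization.ext <;> simp [incl]

omit [NonUnitalNormedRing A] [NormedSpace ℂ A] in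
theorem incl_injective : Function.Injective (incl : A → WithLp 1 (Unitization ℂ A)) := fun _ _ h =>
  congrArg (fun z : WithLp 1 (Unitization ℂ A) => z.ofLp.snd) h

theorem norm_snd_le (z : WithLp 1 (Unitization ℂ A)) : ‖z.ofLp.snd‖ ≤ ‖z‖ := by
  rw [WithLp.unitization_norm_def]
  exact le_add_of_nonneg_left (norm_nonneg _)

theorem norm_fst_le (z : WithLp 1 (Unitization ℂ A)) : ‖z.ofLp.fst‖ ≤ ‖z‖ := by
  rw [WithLp.unitization_norm_def]
  exact le_add_of_nonneg_right (norm_nonneg _)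

theorem continuous_snd_unitization :
    Continuous fun z : WithLp 1 (Unitization ℂ A) => z.ofLp.snd := by
  refine (LipschitzWith.of_dist_le_mul (K := 1) fun z w => ?_).continuous
  rw [dist_eq_norm, dist_eq_norm, NNReal.coe_one, one_mul]
  exact norm_snd_le (z - w)

theorem continuous_fst_unitization :
    Continuous fun z : WithLp 1 (Unitization ℂ A) => z.ofLp.fst := by
  refine (LipschitzWith.of_dist_le_mul (K := 1) fun z w => ?_).continuous
  rw [dist_eq_norm, dist_eq_norm, NNReal.coe_one, one_mul]
  exact norm_fst_le (z - w)

variable [IsScalarTower ℂ A A] [SMulCommClass ℂ A A]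

theorem incl_mul (a b : A) : incl (a * b) = incl a * incl b := by
  apply WithLp.ofLp_injective
  apply Unitization.ext <;> simp [incl]

omit [IsScalarTower ℂ A A] [SMulCommClass ℂ A A] in
theorem incl_smul (c : ℝ) (a : A) : incl (c • a) = c • incl a := by
  rw [← Complex.coe_smul, ← Complex.coe_smul]
  apply WithLp.ofLp_injective
  apply Unitization.ext <;> simp [incl]

theorem incl_lie (a b : A) : incl ⁅a, b⁆ = ad (incl a) (incl b) := by
  rw [Ring.lie_def, sub_eq_add_neg, incl_add, incl_neg, incl_mul, incl_mul, ad_apply,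
    sub_eq_add_neg]

theorem log_eq_rlog {B : Type*} [NormedRing B] [NormedAlgebra ℂ B] (b : B) : log b = rlog b := by
  refine tsum_congr fun n => ?_
  rw [← Complex.coe_smul]
  push_cast
  rfl

/-- The ideal `A` in its unitization. -/
def inclRange (A : Type*) [NonUnitalNormedRing A] [NormedSpace ℂ A] [IsScalarTower ℂ A A]
    [SMulCommClass ℂ A A] : Submodule ℝ (WithLp 1 (Unitization ℂ A)) where
  carrier := {z | z.ofLp.fst = 0}
  zero_mem' := rfl
  add_mem' {z w} hz hw := by
    change z.ofLp.fst + w.ofLp.fst = 0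
    rw [show z.ofLp.fst = 0 from hz, show w.ofLp.fst = 0 from hw, add_zero]
  smul_mem' c z hz := by
    change (c : ℂ) * z.ofLp.fst = 0
    rw [show z.ofLp.fst = 0 from hz, mul_zero]

theorem incl_snd {z : WithLp 1 (Unitization ℂ A)} (hz : z ∈ inclRange A) :
    incl z.ofLp.snd = z := by
  apply WithLp.ofLp_injective
  apply Unitization.ext
  · exact (show z.ofLp.fst = 0 from hz).symm
  · rfl

theorem incl_mem_inclRange (a : A) : incl a ∈ inclRange A := rfl

theorem isClosedLie_inclRange : IsClosedLie (inclRange A) where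
  isClosed := isClosed_eq continuous_fst_unitization continuous_const
  ad_mem a ha b hb := by
    rw [← incl_snd ha, ← incl_snd hb, ← incl_lie]
    exact incl_mem_inclRange _

/-- The skew-adjoint elements of the ideal `A` in its unitization. -/
def inclSkew (A : Type*) [NonUnitalNormedRing A] [NormedSpace ℂ A] [IsScalarTower ℂ A A]
    [SMulCommClass ℂ A A] [StarRing A] [StarModule ℂ A] :
    Submodule ℝ (WithLp 1 (Unitization ℂ A)) where
  carrier := {z | z ∈ inclRange A ∧ z.ofLp.snd ∈ skewAdjoint A}
  zero_mem' := ⟨zero_mem _, zero_mem (skewAdjoint A)⟩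
  add_mem' hz hw := ⟨add_mem hz.1 hw.1, add_mem hz.2 hw.2⟩
  smul_mem' c _ hz := ⟨Submodule.smul_mem _ c hz.1, skewAdjoint.smul_mem c hz.2⟩

theorem isClosedLie_inclSkew [StarRing A] [StarModule ℂ A] [CStarRing A] :
    IsClosedLie (inclSkew A) where
  isClosed := isClosedLie_inclRange.isClosed.inter
    (isClosed_eq (continuous_star.comp continuous_snd_unitization)
      continuous_snd_unitization.neg)
  ad_mem a ha b hb := by
    have ha2 := skewAdjoint.mem_iff.1 ha.2
    have hb2 := skewAdjoint.mem_iff.1 hb.2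
    rw [← incl_snd ha.1, ← incl_snd hb.1, ← incl_lie]
    refine ⟨incl_mem_inclRange _, skewAdjoint.mem_iff.2 ?_⟩
    change star ⁅a.ofLp.snd, b.ofLp.snd⁆ = -⁅a.ofLp.snd, b.ofLp.snd⁆
    rw [Ring.lie_def, star_sub, star_mul, star_mul, ha2, hb2, neg_mul_neg, neg_mul_neg, neg_sub]

theorem incl_mem_inclSkew [StarRing A] [StarModule ℂ A] {a : A} (ha : a ∈ skewAdjoint A) :
    incl a ∈ inclSkew A := ⟨incl_mem_inclRange a, ha⟩

end Unitization

section Value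

open FreeBanach

variable {A : Type*} [NonUnitalNormedRing A] [NormedSpace ℂ A] [IsScalarTower ℂ A A]
  [SMulCommClass ℂ A A] [CompleteSpace A] {r : ℝ}

theorem exists_evalAt (hr : 0 < r) (p : A × A) :
    ∃ θ : FreeBanach →A[ℝ] WithLp 1 (Unitization ℂ A), (∀ a, ‖θ a‖ ≤ ‖a‖) ∧
      (‖p.1‖ ≤ r → ‖p.2‖ ≤ r → θ gx = r⁻¹ • incl p.1 ∧ θ gy = r⁻¹ • incl p.2) := by
  have h1 : ‖(1 : WithLp 1 (Unitization ℂ A))‖ ≤ 1 := by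
    rw [WithLp.unitization_norm_def]
    change ‖(1 : ℂ)‖ + ‖(0 : A)‖ ≤ 1
    simp
  by_cases h : ‖p.1‖ ≤ r ∧ ‖p.2‖ ≤ r
  · have hn : ∀ a : A, ‖a‖ ≤ r → ‖r⁻¹ • incl a‖ ≤ 1 := fun a ha => by
      rw [norm_smul, norm_incl, norm_inv, Real.norm_of_nonneg hr.le, inv_mul_le_iff₀ hr, mul_one]
      exact ha
    obtain ⟨θ, hx, hy, hθ⟩ := exists_eval h1 (hn _ h.1) (hn _ h.2)
    exact ⟨θ, hθ, fun _ _ => ⟨hx, hy⟩⟩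
  · obtain ⟨θ, -, -, hθ⟩ := exists_eval h1 (p := 0) (q := 0) (by simp) (by simp)
    exact ⟨θ, hθ, fun h1 h2 => absurd ⟨h1, h2⟩ h⟩

/-- Evaluation at the pair `p` of elements of the ball of radius `r`, scaled to the unit ball. -/
def evalAt (hr : 0 < r) (p : A × A) : FreeBanach →A[ℝ] WithLp 1 (Unitization ℂ A) :=
  (exists_evalAt hr p).choose

theorem norm_evalAt_le (hr : 0 < r) (p : A × A) (a : FreeBanach) : ‖evalAt hr p a‖ ≤ ‖a‖ :=
  (exists_evalAt hr p).choose_spec.1 a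

theorem evalAt_gx (hr : 0 < r) {p : A × A} (h1 : ‖p.1‖ ≤ r) (h2 : ‖p.2‖ ≤ r) :
    evalAt hr p gx = r⁻¹ • incl p.1 := ((exists_evalAt hr p).choose_spec.2 h1 h2).1

theorem evalAt_gy (hr : 0 < r) {p : A × A} (h1 : ‖p.1‖ ≤ r) (h2 : ‖p.2‖ ≤ r) :
    evalAt hr p gy = r⁻¹ • incl p.2 := ((exists_evalAt hr p).choose_spec.2 h1 h2).2

theorem continuousOn_evalAt (hr : 0 < r) (a : FreeBanach) :
    ContinuousOn (fun p : A × A => evalAt hr p a) {p | ‖p.1‖ ≤ r ∧ ‖p.2‖ ≤ r} := by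
  set K : Set (A × A) := {p | ‖p.1‖ ≤ r ∧ ‖p.2‖ ≤ r} with hK
  let S : Submodule ℝ FreeBanach :=
    { carrier := {a | ContinuousOn (fun p : A × A => evalAt hr p a) K}
      zero_mem' := by
        simp only [Set.mem_ofPred_eq, map_zero]
        exact continuousOn_const
      add_mem' := fun ha hb => by
        simp only [Set.mem_ofPred_eq, map_add] at *
        exact ha.add hb
      smul_mem' := fun c a ha => by
        simp only [Set.mem_ofPred_eq, map_smul] at *
        exact ha.const_smul c }
  have hS : IsClosed (S : Set FreeBanach) := by
    refine isClosed_of_closure_subset fun a ha => ?_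
    refine continuousOn_of_uniform_approx_of_continuousOn fun u hu => ?_
    obtain ⟨ε, hε, hu⟩ := Metric.mem_uniformity_dist.1 hu
    obtain ⟨b, hb, hab⟩ := Metric.mem_closure_iff.1 ha ε hε
    refine ⟨_, hb, fun p _ => hu ?_⟩
    rw [dist_eq_norm, ← map_sub]
    exact (norm_evalAt_le hr p _).trans_lt (by rwa [← dist_eq_norm])
  have hi : Continuous (incl : A → WithLp 1 (Unitization ℂ A)) :=
    WithLp.unitization_isometry_inr.continuous
  refine eq_top_of_word_mem S hS (fun w => ?_) a
  induction w using FreeMonoid.inductionOn' with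
  | one =>
    change ContinuousOn (fun p : A × A => evalAt hr p (word 1)) K
    simp only [word_one, map_one]
    exact continuousOn_const
  | of_mul i w ih =>
    change ContinuousOn (fun p : A × A => evalAt hr p (word (FreeMonoid.of i * w))) K
    simp only [← word_mul, map_mul]
    refine ContinuousOn.mul ?_ ih
    cases i
    · exact (((hi.comp continuous_snd).const_smul r⁻¹).continuousOn (s := K)).congr
        fun p hp => evalAt_gy hr hp.1 hp.2
    · exact (((hi.comp continuous_fst).const_smul r⁻¹).continuousOn (s := K)).congr
        fun p hp => evalAt_gx hr hp.1 hp.2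

/-- The value in `A` of an element of the free Lie algebra. -/
def value (hr : 0 < r) (a : FreeBanach) (p : A × A) : A := (evalAt hr p a).ofLp.snd

theorem continuousOn_value (hr : 0 < r) (a : FreeBanach) :
    ContinuousOn (fun p : A × A => value hr a p) {p | ‖p.1‖ ≤ r ∧ ‖p.2‖ ≤ r} :=
  continuous_snd_unitization.comp_continuousOn (continuousOn_evalAt hr a)

variable {p : A × A} {ρ : FreeBanach}

theorem incl_value (hr : 0 < r) (hρ : ρ ∈ lie) (h1 : ‖p.1‖ ≤ r) (h2 : ‖p.2‖ ≤ r) :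
    incl (value hr ρ p) = evalAt hr p ρ := by
  refine incl_snd (map_mem_of_mem_lie _ isClosedLie_inclRange ?_ ?_ hρ)
  · rw [evalAt_gx hr h1 h2]
    exact Submodule.smul_mem _ _ (incl_mem_inclRange _)
  · rw [evalAt_gy hr h1 h2]
    exact Submodule.smul_mem _ _ (incl_mem_inclRange _)

theorem value_mem_skewAdjoint [StarRing A] [StarModule ℂ A] [CStarRing A] (hr : 0 < r)
    (hρ : ρ ∈ lie) (h1 : ‖p.1‖ ≤ r) (h2 : ‖p.2‖ ≤ r) (hX : p.1 ∈ skewAdjoint A)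
    (hY : p.2 ∈ skewAdjoint A) : value hr ρ p ∈ skewAdjoint A := by
  refine (map_mem_of_mem_lie (evalAt hr p) isClosedLie_inclSkew ?_ ?_ hρ).2
  · rw [evalAt_gx hr h1 h2]
    exact Submodule.smul_mem _ _ (incl_mem_inclSkew hX)
  · rw [evalAt_gy hr h1 h2]
    exact Submodule.smul_mem _ _ (incl_mem_inclSkew hY)

theorem value_zero_zero (hr : 0 < r) (hρ : ρ ∈ lie) : value hr ρ ((0, 0) : A × A) = 0 := by
  have h0 : ‖(0 : A)‖ ≤ r := by simpa using hr.le
  have hbot : IsClosedLie (⊥ : Submodule ℝ (WithLp 1 (Unitization ℂ A))) :=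
    ⟨by simp, fun a ha b _ => by
      rw [(Submodule.mem_bot ℝ).1 ha, map_zero]
      exact zero_mem _⟩
  have h := map_mem_of_mem_lie (evalAt hr ((0, 0) : A × A)) hbot
    (by rw [evalAt_gx hr h0 h0, incl_zero, smul_zero]; exact zero_mem _)
    (by rw [evalAt_gy hr h0 h0, incl_zero, smul_zero]; exact zero_mem _) hρ
  rw [value, (Submodule.mem_bot ℝ).1 h]
  rfl

theorem expA_conj (R X : A) : expA R * expA X * expA (-R) = exp (opC (incl R) (incl X)) := by
  rw [exp_opC, expA, expA, expA, incl_neg]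

theorem incl_conjExp_eq (R X : A) : incl (conjExp R X) = opC (incl R) (incl X) := by
  rw [incl_conjExp, opC_eq, expA, expA, incl_neg]

theorem evalAt_smul_gx (hr : 0 < r) (h1 : ‖p.1‖ ≤ r) (h2 : ‖p.2‖ ≤ r) (c : ℝ) :
    evalAt hr p ((c * r) • gx) = c • incl p.1 := by
  rw [map_smul, evalAt_gx hr h1 h2, smul_smul, mul_assoc, mul_inv_cancel₀ hr.ne', mul_one]

theorem evalAt_smul_gy (hr : 0 < r) (h1 : ‖p.1‖ ≤ r) (h2 : ‖p.2‖ ≤ r) (c : ℝ) :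
    evalAt hr p ((c * r) • gy) = c • incl p.2 := by
  rw [map_smul, evalAt_gy hr h1 h2, smul_smul, mul_assoc, mul_inv_cancel₀ hr.ne', mul_one]

theorem evalAt_ad_gx (hr : 0 < r) (hρ : ρ ∈ lie) (h1 : ‖p.1‖ ≤ r) (h2 : ‖p.2‖ ≤ r) :
    evalAt hr p (ad gx ρ) = incl ⁅p.1, r⁻¹ • value hr ρ p⁆ := by
  rw [map_ad, evalAt_gx hr h1 h2, ← incl_value hr hρ h1 h2, incl_lie, incl_smul, map_smul,
    map_smul, smul_apply]

theorem evalAt_ad_gy (hr : 0 < r) (hρ : ρ ∈ lie) (h1 : ‖p.1‖ ≤ r) (h2 : ‖p.2‖ ≤ r) :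
    evalAt hr p (ad gy ρ) = incl ⁅p.2, r⁻¹ • value hr ρ p⁆ := by
  rw [map_ad, evalAt_gy hr h1 h2, ← incl_value hr hρ h1 h2, incl_lie, incl_smul, map_smul,
    map_smul, smul_apply]

end Value

end
end BanachKV

theorem mainTheorem12 :
    ∃ ε : ℝ, 0 < ε ∧
      ∀ (A : Type*) [NonUnitalNormedRing A] [NormedSpace ℂ A] [IsScalarTower ℂ A A]
        [SMulCommClass ℂ A A] [CompleteSpace A],
      ∃ R S R' R'' S' S'' : A × A → A,
        ContinuousOn R {p : A × A | ‖p.1‖ ≤ ε ∧ ‖p.2‖ ≤ ε} ∧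
        ContinuousOn S {p : A × A | ‖p.1‖ ≤ ε ∧ ‖p.2‖ ≤ ε} ∧
        R (0, 0) = 0 ∧ S (0, 0) = 0 ∧
        (∀ X Y : A, ‖X‖ ≤ ε → ‖Y‖ ≤ ε →
          (‖BanachKV.conjExp (R (X, Y)) X‖ + ‖BanachKV.conjExp (S (X, Y)) Y‖ < Real.log 2 ∧
            BanachKV.V (BanachKV.conjExp (R (X, Y)) X) (BanachKV.conjExp (S (X, Y)) Y)
              = BanachKV.incl (X + Y)) ∧
          BanachKV.expA (X + Y)
            = (BanachKV.expA (R (X, Y)) * BanachKV.expA X * BanachKV.expA (-R (X, Y)))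
              * (BanachKV.expA (S (X, Y)) * BanachKV.expA Y * BanachKV.expA (-S (X, Y))) ∧
          R (X, Y) = (1 / 4 : ℂ) • Y + ⁅X, R' (X, Y)⁆ + ⁅Y, R'' (X, Y)⁆ ∧
          S (X, Y) = -((1 / 4 : ℂ) • X) + ⁅X, S' (X, Y)⁆ + ⁅Y, S'' (X, Y)⁆) ∧
        (∀ [StarRing A] [StarModule ℂ A] [CStarRing A],
          ∀ X Y : A, ‖X‖ ≤ ε → ‖Y‖ ≤ ε → X ∈ skewAdjoint A → Y ∈ skewAdjoint A →
            R (X, Y) ∈ skewAdjoint A ∧ R' (X, Y) ∈ skewAdjoint A ∧ R'' (X, Y) ∈ skewAdjoint A ∧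
            S (X, Y) ∈ skewAdjoint A ∧ S' (X, Y) ∈ skewAdjoint A ∧ S'' (X, Y) ∈ skewAdjoint A) := by
  obtain ⟨r, hr, R, hR, S, hS, R', hR', R'', hR'', S', hS', S'', hS'', hnx, hny, hexp, hRe, hSe,
    hr16⟩ := BanachKV.FreeBanach.exists_solution
  refine ⟨r, hr, fun A _ _ _ _ _ => ?_⟩
  refine ⟨BanachKV.value hr R, BanachKV.value hr S, fun p => r⁻¹ • BanachKV.value hr R' p,
    fun p => r⁻¹ • BanachKV.value hr R'' p, fun p => r⁻¹ • BanachKV.value hr S' p,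
    fun p => r⁻¹ • BanachKV.value hr S'' p, BanachKV.continuousOn_value hr R,
    BanachKV.continuousOn_value hr S, BanachKV.value_zero_zero hr hR,
    BanachKV.value_zero_zero hr hS, fun X Y hX hY => ?_, fun X Y hX hY hXs hYs => ?_⟩
  · have hx : BanachKV.evalAt hr (X, Y) (r • BanachKV.FreeBanach.gx) = BanachKV.incl X := by
      simpa using BanachKV.evalAt_smul_gx hr (p := (X, Y)) hX hY 1
    have hy : BanachKV.evalAt hr (X, Y) (r • BanachKV.FreeBanach.gy) = BanachKV.incl Y := by
      simpa using BanachKV.evalAt_smul_gy hr (p := (X, Y)) hX hY 1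
    have hcx : BanachKV.incl (BanachKV.conjExp (BanachKV.value hr R (X, Y)) X) =
        BanachKV.evalAt hr (X, Y) (BanachKV.opC R (r • BanachKV.FreeBanach.gx)) := by
      rw [BanachKV.incl_conjExp_eq, BanachKV.FreeBanach.map_opC, hx,
        BanachKV.incl_value hr hR hX hY]
    have hcy : BanachKV.incl (BanachKV.conjExp (BanachKV.value hr S (X, Y)) Y) =
        BanachKV.evalAt hr (X, Y) (BanachKV.opC S (r • BanachKV.FreeBanach.gy)) := by
      rw [BanachKV.incl_conjExp_eq, BanachKV.FreeBanach.map_opC, hy,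
        BanachKV.incl_value hr hS hX hY]
    have hprod : NormedSpace.exp (BanachKV.incl (BanachKV.conjExp (BanachKV.value hr R (X, Y)) X)) *
        NormedSpace.exp (BanachKV.incl (BanachKV.conjExp (BanachKV.value hr S (X, Y)) Y)) =
        NormedSpace.exp (BanachKV.incl (X + Y)) := by
      rw [hcx, hcy, ← BanachKV.FreeBanach.map_exp, ← BanachKV.FreeBanach.map_exp, ← map_mul, hexp,
        BanachKV.FreeBanach.map_exp, map_add, hx, hy, BanachKV.incl_add]
    have hlog2 : (1 / 8 : ℝ) < Real.log 2 := by linarith [Real.log_two_gt_d9]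
    refine ⟨⟨?_, ?_⟩, ?_, ?_, ?_⟩
    · rw [← BanachKV.norm_incl (BanachKV.conjExp _ X), hcx,
        ← BanachKV.norm_incl (BanachKV.conjExp _ Y), hcy]
      have h1 := (BanachKV.norm_evalAt_le hr (X, Y) _).trans hnx
      have h2 := (BanachKV.norm_evalAt_le hr (X, Y) _).trans hny
      linarith
    · rw [BanachKV.V, BanachKV.log_eq_rlog, BanachKV.expA, BanachKV.expA, hprod]
      refine BanachKV.rlog_exp ?_
      rw [BanachKV.norm_incl]
      linarith [norm_add_le X Y]
    · rw [BanachKV.expA_conj, BanachKV.expA_conj, ← BanachKV.incl_conjExp_eq,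
        ← BanachKV.incl_conjExp_eq, hprod, BanachKV.expA]
    · apply BanachKV.incl_injective
      have h4 : (1 / 4 : ℂ) • Y = (1 / 4 : ℝ) • Y := by
        rw [← Complex.coe_smul]; norm_num
      rw [BanachKV.incl_value hr hR hX hY, hRe, map_add, map_add,
        BanachKV.evalAt_ad_gx hr hR' hX hY, BanachKV.evalAt_ad_gy hr hR'' hX hY,
        div_eq_inv_mul, BanachKV.evalAt_smul_gy hr hX hY, BanachKV.incl_add, BanachKV.incl_add, h4,
        BanachKV.incl_smul, one_div]
    · apply BanachKV.incl_injective
      have h4 : (1 / 4 : ℂ) • X = (1 / 4 : ℝ) • X := by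
        rw [← Complex.coe_smul]; norm_num
      rw [BanachKV.incl_value hr hS hX hY, hSe, map_add, map_add, map_neg,
        BanachKV.evalAt_ad_gx hr hS' hX hY, BanachKV.evalAt_ad_gy hr hS'' hX hY,
        div_eq_inv_mul, BanachKV.evalAt_smul_gx hr hX hY, BanachKV.incl_add, BanachKV.incl_add,
        BanachKV.incl_neg, h4, BanachKV.incl_smul, one_div]
  · have h : ∀ {ρ : BanachKV.FreeBanach}, ρ ∈ BanachKV.FreeBanach.lie →
        BanachKV.value hr ρ (X, Y) ∈ skewAdjoint A := fun hρ =>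
      BanachKV.value_mem_skewAdjoint hr hρ hX hY hXs hYs
    exact ⟨h hR, skewAdjoint.smul_mem _ (h hR'), skewAdjoint.smul_mem _ (h hR''), h hS,
      skewAdjoint.smul_mem _ (h hS'), skewAdjoint.smul_mem _ (h hS'')⟩
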